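/- Let $\ell\ge 1$ be an integer, $n=2\ell$, and work over $\mathbb C$. For a $2\times n$ matrix $A$ and an $\ell\times n$ matrix $B$ with columns $A_c$, $B_c$, let $\mathrm{Seg}_{2,\ell}(A,B)$ be the determinant of the $n\times n$ matrix with columns $A_c\otimes B_c$. Let $\mathrm{Gr}(2,n)^\circ\subset \mathrm{Gr}(2,n)$ be the set of points all of whose Plücker coordinates are nonzero, and let $$\pi:\mathrm{Gr}(2,n)^\circ\to\mathbb P H^0(\mathrm{Gr}(\ell,n),\mathcal O(2)),\qquad A\mapsto \mathrm{Seg}_{2,\ell}(A,B),$$ where $\mathrm{Seg}_{2,\ell}(A,B)$ is regarded as a polynomial in $B$, up to scaling. The Segre coefficient variety $\mathrm{Coeff}(\mathrm{Seg}_{2,\ell})$ is the Zariski closure of the image of $\pi$, with its reduced structure. Let $$(\mathbb P^1)^{2\ell}/\!/\mathrm{SL}_2=\mathrm{Proj}\,\bigoplus_{d\ge 0}H^0\big((\mathbb P^1)^{2\ell},\mathcal O(d,\dots,d)\big)^{\mathrm{SL}_2}$$ be the GIT quotient with respect to the linearization $(1,\dots,1)$. Then: 1. $\mathrm{Coeff}(\mathrm{Seg}_{2,\ell})$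 is isomorphic to $(\mathbb P^1)^{2\ell}/\!/\mathrm{SL}_2$ as a scheme over $\mathbb C$. 2. The Segre determinant determines generic torus orbit closures in $\mathrm{Gr}(2,2\ell)$: for $A,A'\in\mathrm{Gr}(2,2\ell)^\circ$ one has $\pi(A)=\pi(A')$ if and only if the Zariski closures in $\mathrm{Gr}(2,2\ell)$ of the orbits of $A$ and $A'$ under the torus $(\mathbb C^*)^{2\ell}$ coincide. -/

import Mathlib

open MvPolynomial DirectSum CategoryTheory AlgebraicGeometry
open scoped LinearAlgebra.Projectivization

noncomputable section

namespace SegreCoeff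

/-! ## The Segre determinant -/

/-- The Segre matrix of `A` and `B`: its `c`-th column is `A_c ⊗ B_c`, where `A_c` and `B_c` are the
`c`-th columns; the rows are the pairs `(i, j)` in lexicographic order. -/
def segreMatrix {R : Type*} [CommRing R] {k ℓ : ℕ} (A : Matrix (Fin k) (Fin (k * ℓ)) R)
    (B : Matrix (Fin ℓ) (Fin (k * ℓ)) R) : Matrix (Fin (k * ℓ)) (Fin (k * ℓ)) R :=
  Matrix.of fun r c => A (finProdFinEquiv.symm r).1 c * B (finProdFinEquiv.symm r).2 c

/-- The Segre determinant. -/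
def segreDet {R : Type*} [CommRing R] {k ℓ : ℕ} (A : Matrix (Fin k) (Fin (k * ℓ)) R)
    (B : Matrix (Fin ℓ) (Fin (k * ℓ)) R) : R :=
  (segreMatrix A B).det

/-- `Seg(A, B)` for a fixed complex matrix `A`, as a polynomial in the entries `b_{ij}` of the
generic matrix `B`. -/
def segreForm {k ℓ : ℕ} (A : Matrix (Fin k) (Fin (k * ℓ)) ℂ) :
    MvPolynomial (Fin ℓ × Fin (k * ℓ)) ℂ :=
  segreDet (A.map C) (Matrix.of fun i j => X (i, j))

/-! ## Grassmannians -/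

/-- The complex points of the Grassmannian `Gr(k, n)`: the `k`-dimensional subspaces of `ℂⁿ`. -/
def Gr (k n : ℕ) : Type := {W : Submodule ℂ (Fin n → ℂ) // Module.finrank ℂ W = k}

/-- A `k × n` matrix whose rows are a basis of `W`. Another choice of basis multiplies all
Plücker coordinates of `W`, and the Segre determinant, by a nonzero constant. -/
def Gr.matrix {k n : ℕ} (W : Gr k n) : Matrix (Fin k) (Fin n) ℂ :=
  Matrix.of fun i => (Module.finBasisOfFinrankEq ℂ W.1 W.2 i : Fin n → ℂ)

/-- Plücker coordinates: the `k × k` minors, indexed by the `k`-subsets of the columns. -/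
def Gr.plucker {k n : ℕ} (W : Gr k n) (I : Fin k ↪o Fin n) : ℂ :=
  (W.matrix.submatrix id I).det

/-- The matroid of `W` is uniform: all Plücker coordinates are nonzero. -/
def Gr.IsUniform {k n : ℕ} (W : Gr k n) : Prop :=
  ∀ I : Fin k ↪o Fin n, W.plucker I ≠ 0

/-- The torus `(ℂˣ)ⁿ` acts on `Gr(k, n)` by rescaling the coordinates of `ℂⁿ`. -/
def Gr.torusAct {k n : ℕ} (t : Fin n → ℂˣ) (W : Gr k n) : Gr k n :=
  ⟨W.1.map (LinearEquiv.piCongrRight fun j => LinearEquiv.smulOfUnit (t j) :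
      (Fin n → ℂ) ≃ₗ[ℂ] (Fin n → ℂ)).toLinearMap, by
    rw [LinearEquiv.finrank_map_eq]; exact W.2⟩

/-- The Zariski closure in `Gr(k, n)` of the torus orbit of `W`. The Zariski closed subsets of
`Gr(k, n)` are the zero loci of homogeneous polynomials in the Plücker coordinates. -/
def Gr.orbitClosure {k n : ℕ} (W : Gr k n) : Set (Gr k n) :=
  {U | ∀ (d : ℕ) (F : MvPolynomial (Fin k ↪o Fin n) ℂ), F.IsHomogeneous d →
    (∀ t : Fin n → ℂˣ, eval (W.torusAct t).plucker F = 0) → eval U.plucker F = 0}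

/-! ## Linear substitutions and sections of line bundles -/

/-- The substitution `f(B) ↦ f(g B)` on polynomials in the entries of a generic `m × n`
matrix `B`. -/
def leftSubst {m : ℕ} (n : ℕ) (g : Matrix (Fin m) (Fin m) ℂ) :
    MvPolynomial (Fin m × Fin n) ℂ →ₐ[ℂ] MvPolynomial (Fin m × Fin n) ℂ :=
  aeval fun p => ∑ i, C (g p.1 i) * X (i, p.2)

/-- The space `H⁰(Gr(m, n), 𝒪(d))` in Stiefel coordinates: the polynomials `f` in the entries of
an `m × n` matrix `B` (whose row space is the point of the Grassmannian) with
`f(g B) = det(g)ᵈ f(B)` for all `g ∈ GL_m`. -/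
def grSections (m n d : ℕ) : Submodule ℂ (MvPolynomial (Fin m × Fin n) ℂ) where
  carrier := {f | ∀ g : GL (Fin m) ℂ, leftSubst n g.1 f = g.1.det ^ d • f}
  zero_mem' := fun g => by simp
  add_mem' := fun {f f'} hf hf' g => by
    rw [map_add, hf g, hf' g, smul_add]
  smul_mem' := fun c f hf g => by
    rw [map_smul, hf g, smul_comm]

lemma segreForm_mem {k ℓ : ℕ} (A : Matrix (Fin k) (Fin (k * ℓ)) ℂ) :
    segreForm A ∈ grSections ℓ (k * ℓ) k := by
  intro g
  have hdet : leftSubst (k * ℓ) g.1 (segreForm A) =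
      (((Matrix.kronecker (1 : Matrix (Fin k) (Fin k) (MvPolynomial (Fin ℓ × Fin (k * ℓ)) ℂ))
        (g.1.map C)).submatrix finProdFinEquiv.symm finProdFinEquiv.symm) *
        segreMatrix (A.map C) (Matrix.of fun i j => X (i, j))).det := by
    rw [segreForm, segreDet, AlgHom.map_det]
    congr 1
    ext1 r c
    rw [Matrix.mul_apply, ← finProdFinEquiv.sum_comp, Fintype.sum_prod_type]
    simp only [segreMatrix, leftSubst, Matrix.of_apply, AlgHom.mapMatrix_apply, Matrix.map_apply,
      map_mul, aeval_X, Matrix.submatrix_apply, Matrix.kronecker, Matrix.kroneckerMap_apply,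
      Matrix.one_apply, Equiv.symm_apply_apply, ite_mul, one_mul, zero_mul,
      Finset.sum_ite_irrel, Finset.sum_const_zero, Finset.sum_ite_eq, Finset.mem_univ, if_true,
      Finset.mul_sum, algHom_C, algebraMap_eq]
    exact Finset.sum_congr rfl fun x _ => by ring
  rw [hdet, Matrix.det_mul, Matrix.det_submatrix_equiv_self, Matrix.kronecker,
    Matrix.det_kronecker]
  rw [← RingHom.mapMatrix_apply, ← RingHom.map_det]
  simp [segreForm, segreDet, smul_eq_C_mul]

/-- `H⁰(Gr(m, n), 𝒪(d))` is finite-dimensional. -/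
lemma grSections_finite (m n d : ℕ) : FiniteDimensional ℂ (grSections m n d) := by
  have hc : ∀ (f : MvPolynomial (Fin m × Fin n) ℂ) (s : Fin m × Fin n →₀ ℕ),
      coeff s (leftSubst n (Matrix.scalar (Fin m) (2 : ℂ)) f) = 2 ^ s.degree * coeff s f := by
    intro f s
    induction f using MvPolynomial.induction_on' with
    | monomial u a =>
      have h1 : leftSubst n (Matrix.scalar (Fin m) (2 : ℂ)) (monomial u a)
          = monomial u (2 ^ u.degree * a) := by
        rw [leftSubst, aeval_monomial, monomial_eq (s := u) (a := 2 ^ u.degree * a), algebraMap_eq]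
        simp only [Matrix.scalar_apply, Matrix.diagonal_apply, apply_ite C, map_zero, ite_mul,
          zero_mul, Finset.sum_ite_eq, Finset.mem_univ, if_true, mul_pow, Finsupp.prod_mul,
          C_mul, C_pow]
        have h2 : (u.prod fun _ b => (C (2 : ℂ) : MvPolynomial (Fin m × Fin n) ℂ) ^ b)
            = C 2 ^ u.degree := by
          rw [Finsupp.prod, Finset.prod_pow_eq_pow_sum]; rfl
        rw [h2]; ring
      rw [h1, coeff_monomial, coeff_monomial]
      split_ifs with h
      · rw [h]
      · simp
    | add p q hp hq => rw [map_add, coeff_add, coeff_add, hp, hq, mul_add]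
  have key : grSections m n d ≤ restrictTotalDegree (Fin m × Fin n) ℂ (m * d) := by
    intro f hf
    rw [mem_restrictTotalDegree]
    refine Finset.sup_le fun s hs => ?_
    have h2 : IsUnit (Matrix.scalar (Fin m) (2 : ℂ)).det := by
      simp
    have h := congrArg (coeff s) (hf (Matrix.GeneralLinearGroup.mk'' _ h2))
    rw [show (Matrix.GeneralLinearGroup.mk'' _ h2).1 = Matrix.scalar (Fin m) (2 : ℂ) from rfl,
      hc, coeff_smul, smul_eq_mul] at h
    have h3 := mul_right_cancel₀ (mem_support_iff.mp hs) h
    have h4 : (Matrix.scalar (Fin m) (2 : ℂ)).det ^ d = 2 ^ (m * d) := by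
      simp [pow_mul]
    rw [h4] at h3
    have h5 : s.degree = m * d := Nat.pow_right_injective le_rfl (by
      have : ((2 ^ s.degree : ℕ) : ℂ) = ((2 ^ (m * d) : ℕ) : ℂ) := by push_cast; exact h3
      exact_mod_cast this)
    exact h5.le
  exact Submodule.finiteDimensional_of_le key

/-- The Segre form of a matrix with nonzero maximal minors is nonzero. -/
lemma segreForm_ne_zero {k ℓ : ℕ} (A : Matrix (Fin k) (Fin (k * ℓ)) ℂ)
    (hA : ∀ I : Fin k ↪o Fin (k * ℓ), (A.submatrix id I).det ≠ 0) : segreForm A ≠ 0 := by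
  intro h
  let B : Matrix (Fin ℓ) (Fin (k * ℓ)) ℂ :=
    Matrix.of fun j c => if (finProdFinEquiv.symm c).2 = j then 1 else 0
  have h1 : eval (fun p : Fin ℓ × Fin (k * ℓ) => B p.1 p.2) (segreForm A) = segreDet A B := by
    rw [segreForm, segreDet, RingHom.map_det, segreDet]
    congr 1
    ext1 r c
    simp [segreMatrix]
  let I : Fin ℓ → (Fin k ↪o Fin (k * ℓ)) := fun j =>
    OrderEmbedding.ofStrictMono (fun i => finProdFinEquiv (i, j)) (by
      intro a b hab
      have hl : 0 < ℓ := j.pos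
      have hab' : a.1 < b.1 := hab
      change (finProdFinEquiv (a, j)).1 < (finProdFinEquiv (b, j)).1
      simp only [finProdFinEquiv_apply_val]
      have := Nat.mul_lt_mul_of_pos_left hab' hl
      omega)
  have h2 : segreDet A B = ∏ j, (A.submatrix id (I j)).det := by
    rw [← Matrix.det_blockDiagonal, segreDet,
      ← Matrix.det_submatrix_equiv_self finProdFinEquiv (segreMatrix A B)]
    congr 1
    ext ⟨i, j⟩ ⟨i', j'⟩
    simp only [segreMatrix, B, Matrix.submatrix_apply, Matrix.of_apply,
      Equiv.symm_apply_apply, Matrix.blockDiagonal_apply, id, eq_comm (a := j)]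
    by_cases hj : j' = j
    · subst hj; simp only [if_true, mul_one]; rfl
    · simp [hj]
  rw [h, map_zero, h2] at h1
  exact (Finset.prod_ne_zero_iff.mpr fun j _ => hA (I j)) h1.symm

/-- The Segre coefficient map `π : Gr(k, kℓ)° → ℙ H⁰(Gr(ℓ, kℓ), 𝒪(k))`, `A ↦ Seg(A, B)`. -/
def segreMap {k ℓ : ℕ} (W : Gr k (k * ℓ)) (hW : W.IsUniform) :
    ℙ ℂ (grSections ℓ (k * ℓ) k) :=
  Projectivization.mk ℂ ⟨segreForm W.matrix, segreForm_mem W.matrix⟩ fun h =>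
    segreForm_ne_zero W.matrix hW (congrArg Subtype.val h)

/-! ## `Proj` over `ℂ` and projective varieties -/

/-- `Proj` of a graded `ℂ`-algebra, as a scheme over `Spec ℂ`. -/
def projOver {A : Type} [CommRing A] [Algebra ℂ A] (𝒜 : ℕ → Submodule ℂ A) [GradedAlgebra 𝒜] :
    Over (Spec (CommRingCat.of ℂ)) :=
  Over.mk (Proj.toSpecZero 𝒜 ≫ Spec.map (CommRingCat.ofHom (algebraMap ℂ (𝒜 0))))

/-- The Zariski closure of a subset of `ℙ^{N-1}`. -/
def zariskiClosure {N : ℕ} (S : Set (ℙ ℂ (Fin N → ℂ))) : Set (ℙ ℂ (Fin N → ℂ)) :=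
  {p | ∀ (d : ℕ) (F : MvPolynomial (Fin N) ℂ), F.IsHomogeneous d →
    (∀ q ∈ S, eval q.rep F = 0) → eval p.rep F = 0}

/-- The homogeneous ideal generated by the homogeneous polynomials that vanish on `S`. -/
def vanishingIdeal {N : ℕ} (S : Set (ℙ ℂ (Fin N → ℂ))) : Ideal (MvPolynomial (Fin N) ℂ) :=
  Ideal.span {F | (∃ d, F.IsHomogeneous d) ∧ ∀ q ∈ S, eval q.rep F = 0}

/-- The homogeneous coordinate ring `ℂ[x₁, …, x_N] / I(S)`. -/
abbrev CoordRing {N : ℕ} (S : Set (ℙ ℂ (Fin N → ℂ))) : Type :=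
  MvPolynomial (Fin N) ℂ ⧸ vanishingIdeal S

/-- The grading of the homogeneous coordinate ring by degree. -/
def coordGrading {N : ℕ} (S : Set (ℙ ℂ (Fin N → ℂ))) (d : ℕ) : Submodule ℂ (CoordRing S) :=
  (homogeneousSubmodule (Fin N) ℂ d).map (Ideal.Quotient.mkₐ ℂ (vanishingIdeal S)).toLinearMap

instance coordGrading_gradedMonoid {N : ℕ} (S : Set (ℙ ℂ (Fin N → ℂ))) :
    SetLike.GradedMonoid (coordGrading S) where
  one_mem := ⟨1, isHomogeneous_one _ _, map_one (Ideal.Quotient.mkₐ ℂ (vanishingIdeal S))⟩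
  mul_mem := by
    rintro i j _ _ ⟨f, hf, rfl⟩ ⟨g, hg, rfl⟩
    exact ⟨f * g, IsHomogeneous.mul hf hg, map_mul (Ideal.Quotient.mkₐ ℂ (vanishingIdeal S)) f g⟩

/-- The decomposition of a polynomial into the classes of its homogeneous components. -/
def coordDecompAux {N : ℕ} (S : Set (ℙ ℂ (Fin N → ℂ))) :
    MvPolynomial (Fin N) ℂ →ₐ[ℂ] ⨁ d, coordGrading S d :=
  letI : GradedAlgebra (homogeneousSubmodule (Fin N) ℂ) := MvPolynomial.gradedAlgebra
  (DirectSum.toAlgebra ℂ (fun d => homogeneousSubmodule (Fin N) ℂ d)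
    (fun d => (DirectSum.lof ℂ ℕ (fun d => coordGrading S d) d).comp
      ((Ideal.Quotient.mkₐ ℂ (vanishingIdeal S)).toLinearMap.submoduleMap
        (homogeneousSubmodule (Fin N) ℂ d)))
    rfl (fun a b => by
      refine Eq.trans ?_ (DirectSum.of_mul_of (A := fun d => coordGrading S d) _ _).symm
      exact congrArg (DirectSum.of (fun d => coordGrading S d) _) (Subtype.ext
        (map_mul (Ideal.Quotient.mkₐ ℂ (vanishingIdeal S)) a.1 b.1)))).comp
  (DirectSum.decomposeAlgEquiv (homogeneousSubmodule (Fin N) ℂ)).toAlgHom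

lemma coordDecompAux_apply {N : ℕ} (S : Set (ℙ ℂ (Fin N → ℂ))) (d : ℕ)
    (F : MvPolynomial (Fin N) ℂ) (hF : F.IsHomogeneous d) :
    coordDecompAux S F = DirectSum.of (fun d => coordGrading S d) d
      ⟨Ideal.Quotient.mk _ F, F, hF, rfl⟩ := by
  let _ : GradedAlgebra (homogeneousSubmodule (Fin N) ℂ) := MvPolynomial.gradedAlgebra
  have h : DirectSum.decompose (homogeneousSubmodule (Fin N) ℂ) F =
      DirectSum.of (fun d => homogeneousSubmodule (Fin N) ℂ d) d ⟨F, hF⟩ :=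
    DirectSum.decompose_of_mem _ hF
  rw [coordDecompAux, AlgHom.comp_apply]
  change DirectSum.toAlgebra ℂ (fun d => homogeneousSubmodule (Fin N) ℂ d) _ _ _
    (DirectSum.decompose (homogeneousSubmodule (Fin N) ℂ) F) = _
  rw [h]
  exact DirectSum.toAddMonoid_of _ _ _

instance coordGrading_gradedAlgebra {N : ℕ} (S : Set (ℙ ℂ (Fin N → ℂ))) :
    GradedAlgebra (coordGrading S) :=
  GradedAlgebra.ofAlgHom _
    (Ideal.Quotient.liftₐ (vanishingIdeal S) (coordDecompAux S) (by
      suffices h : vanishingIdeal S ≤ RingHom.ker (coordDecompAux S) from fun a ha => h ha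
      refine Ideal.span_le.mpr ?_
      rintro F ⟨⟨d, hd⟩, hF⟩
      have h0 : Ideal.Quotient.mk (vanishingIdeal S) F = 0 :=
        Ideal.Quotient.eq_zero_iff_mem.mpr (Ideal.subset_span ⟨⟨d, hd⟩, hF⟩)
      rw [SetLike.mem_coe, RingHom.mem_ker, coordDecompAux_apply S d F hd]
      simp only [h0]
      exact map_zero _))
    (by
      refine Ideal.Quotient.algHom_ext _ ?_
      refine MvPolynomial.algHom_ext fun i => ?_
      change DirectSum.coeAlgHom _ (coordDecompAux S (X i)) = _
      rw [coordDecompAux_apply S 1 (X i) (isHomogeneous_X _ _), DirectSum.coeAlgHom_of]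
      rfl)
    (by
      rintro d ⟨_, F, hF, rfl⟩
      exact coordDecompAux_apply S d F hF)

/-- A closed subset of `ℙ^{N-1}` as a reduced projective scheme over `ℂ`: `Proj` of its
homogeneous coordinate ring. -/
def projVariety {N : ℕ} (S : Set (ℙ ℂ (Fin N → ℂ))) : Over (Spec (CommRingCat.of ℂ)) :=
  projOver (coordGrading S)

/-! ## The Segre coefficient variety -/

/-- The Segre coefficient variety: the Zariski closure of the image of `π`, in the homogeneous
coordinates on `ℙ H⁰(Gr(ℓ, kℓ), 𝒪(k))` given by a basis `e`. -/
def coeffVariety {k ℓ N : ℕ} (e : Module.Basis (Fin N) ℂ (grSections ℓ (k * ℓ) k)) :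
    Set (ℙ ℂ (Fin N → ℂ)) :=
  zariskiClosure {p | ∃ (W : Gr k (k * ℓ)) (hW : W.IsUniform),
    p = Projectivization.map e.equivFun.toLinearMap e.equivFun.injective (segreMap W hW)}

/-! ## The GIT quotient `(ℙ¹)ⁿ // SL₂` -/

/-- The `SL₂`-invariants in `H⁰((ℙ¹)ⁿ, 𝒪(d, …, d))`: the polynomials in the entries of a `2 × n`
matrix `A` (the columns being the homogeneous coordinates of the `n` points) that are homogeneous
of degree `d` in each column and satisfy `f(g A) = f(A)` for all `g ∈ SL₂`. -/
def gitInvariants (n d : ℕ) : Submodule ℂ (MvPolynomial (Fin 2 × Fin n) ℂ) where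
  carrier := {f | IsWeightedHomogeneous (fun p : Fin 2 × Fin n => (Pi.single p.2 1 : Fin n → ℕ)) f
      (fun _ => d) ∧
    ∀ g : Matrix.SpecialLinearGroup (Fin 2) ℂ, leftSubst n g.1 f = f}
  zero_mem' := ⟨isWeightedHomogeneous_zero _ _ _, fun g => map_zero _⟩
  add_mem' := fun {f f'} hf hf' => ⟨hf.1.add hf'.1, fun g => by rw [map_add, hf.2 g, hf'.2 g]⟩
  smul_mem' := fun c f hf => ⟨(weightedHomogeneousSubmodule ℂ _ _).smul_mem c hf.1,
    fun g => by rw [map_smul, hf.2 g]⟩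

instance gitInvariants_gradedMonoid (n : ℕ) : SetLike.GradedMonoid (gitInvariants n) where
  one_mem := ⟨isWeightedHomogeneous_one _ _, fun g => map_one _⟩
  mul_mem := fun {i j f f'} hf hf' => ⟨hf.1.mul hf'.1, fun g => by rw [map_mul, hf.2 g, hf'.2 g]⟩

/-- The graded ring `R = ⨁_d H⁰((ℙ¹)ⁿ, 𝒪(d, …, d))^{SL₂}`. -/
def GitRing (n : ℕ) : Type := ⨁ d, gitInvariants n d

instance (n : ℕ) : CommRing (GitRing n) := inferInstanceAs (CommRing (⨁ d, gitInvariants n d))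

instance (n : ℕ) : Algebra ℂ (GitRing n) := inferInstanceAs (Algebra ℂ (⨁ d, gitInvariants n d))

/-- The inclusion of the `d`-th summand. -/
def gitOf (n d : ℕ) : gitInvariants n d →ₗ[ℂ] GitRing n :=
  DirectSum.lof ℂ ℕ (fun d => gitInvariants n d) d

/-- The `d`-th graded piece of `R`. -/
def gitGrading (n d : ℕ) : Submodule ℂ (GitRing n) := LinearMap.range (gitOf n d)

lemma gitOf_mul (n : ℕ) {i j : ℕ} (f : gitInvariants n i) (g : gitInvariants n j) :
    gitOf n (i + j) (GradedMonoid.GMul.mul (A := fun d => gitInvariants n d) f g) =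
      gitOf n i f * gitOf n j g :=
  (DirectSum.of_mul_of (A := fun d => gitInvariants n d) f g).symm

instance gitGrading_gradedMonoid (n : ℕ) : SetLike.GradedMonoid (gitGrading n) where
  one_mem := ⟨GradedMonoid.GOne.one (A := fun d => gitInvariants n d), rfl⟩
  mul_mem := by
    rintro i j _ _ ⟨f, rfl⟩ ⟨g, rfl⟩
    exact ⟨_, gitOf_mul n f g⟩

/-- The decomposition of an element of `R` into its components. -/
def gitDecomp (n : ℕ) : GitRing n →ₐ[ℂ] ⨁ d, gitGrading n d :=
  DirectSum.toAlgebra ℂ (fun d => gitInvariants n d)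
    (fun d => (DirectSum.lof ℂ ℕ (fun d => gitGrading n d) d).comp (gitOf n d).rangeRestrict)
    rfl (fun a b => by
      refine Eq.trans ?_ (DirectSum.of_mul_of (A := fun d => gitGrading n d) _ _).symm
      exact congrArg (DirectSum.of (fun d => gitGrading n d) _) (Subtype.ext (gitOf_mul n a b)))

lemma gitDecomp_gitOf (n d : ℕ) (f : gitInvariants n d) :
    gitDecomp n (gitOf n d f) =
      DirectSum.of (fun d => gitGrading n d) d ⟨gitOf n d f, f, rfl⟩ :=
  DirectSum.toAddMonoid_of (β := fun d => gitInvariants n d)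
    (fun d => ((DirectSum.lof ℂ ℕ (fun d => gitGrading n d) d).comp
      (gitOf n d).rangeRestrict).toAddMonoidHom) d f

instance gitGrading_gradedAlgebra (n : ℕ) : GradedAlgebra (gitGrading n) :=
  GradedAlgebra.ofAlgHom _ (gitDecomp n)
    (by
      refine DirectSum.algHom_ext' ℂ (fun d => gitInvariants n d) fun d => LinearMap.ext fun f => ?_
      change DirectSum.coeAlgHom _ (gitDecomp n (gitOf n d f)) = gitOf n d f
      rw [gitDecomp_gitOf, DirectSum.coeAlgHom_of])
    (by
      rintro d ⟨_, f, rfl⟩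
      exact gitDecomp_gitOf n d f)

/-- The GIT quotient `(ℙ¹)ⁿ // SL₂` with respect to the linearization `(1, …, 1)`. -/
def gitQuotient (n : ℕ) : Over (Spec (CommRingCat.of ℂ)) :=
  projOver (gitGrading n)

end SegreCoeff

end

noncomputable section

namespace SegreCoeff

/-! ### Functoriality of `Proj` over the complex numbers. -/

section ProjIso

open HomogeneousIdeal

variable {A B : Type} [CommRing A] [Algebra ℂ A] [CommRing B] [Algebra ℂ B]
  {𝒜 : ℕ → Submodule ℂ A} {ℬ : ℕ → Submodule ℂ B} [GradedAlgebra 𝒜] [GradedAlgebra ℬ]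

/-! Expand Seg(A, B) in B. Each coefficient is a polynomial in A, linear in every column and
SL₂-invariant, because replacing A by gA multiplies the Segre matrix by g ⊗ 1. If the columns of B
are standard basis vectors, each occurring at one pair of columns, the Segre matrix is block
diagonal up to reordering, and its determinant is, up to sign, a product of 2 × 2 minors of A over a
perfect matching of the columns. So every matching product is a coefficient
(`matchingPoly_mem_range_segreCoeff`).

By Kempe's theorem (`invariants_le_span_matchingPoly_pow`) the matching products generate the
invariant ring in degree one. Its proof has three ingredients: the first fundamental theorem reduces
to bracket monomials, viewed as multigraphs; Plücker relations make these graphs bipartite; Hall's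
theorem splits a regular bipartite multigraph into perfect matchings. Hence pulling back homogeneous
coordinates along π maps onto the invariant ring. Uniform matrices are Zariski dense, so the kernel
is the vanishing ideal of the coefficient variety (`vanishingIdeal_eq_ker`). The two graded rings
are isomorphic, hence so are their `Proj`s.

For torus orbits, two matchings that differ by exchanging partners in two edges have as quotient a
cross-ratio of four columns. Equal Segre points therefore have equal cross-ratios
(`cross_ratio_eq`), and two configurations with equal cross-ratios differ by a projective
transformation, so the subspaces lie in one torus orbit. Conversely, the coefficients are forms of
degree ℓ in the Plücker coordinates and scale by a common factor along an orbit, so proportionality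
of Segre forms is a closed condition that persists on the orbit closure. -/

lemma irrelevant_le_map_of_surjective (f : 𝒜 →+*ᵍ ℬ)
    (hf : ∀ d, ∀ b ∈ ℬ d, ∃ a ∈ 𝒜 d, f a = b) :
    HomogeneousIdeal.irrelevant ℬ ≤ (HomogeneousIdeal.irrelevant 𝒜).map f := by
  rw [← toIdeal_le_toIdeal_iff, toIdeal_map, toIdeal_irrelevant_le]
  intro d hd b hb
  obtain ⟨a, ha, rfl⟩ := hf d b hb
  exact Ideal.mem_map_of_mem _ (mem_irrelevant_of_mem 𝒜 hd ha)

/-- The structure morphism of `Proj` of a graded `ℂ`-algebra. -/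
def projStructure (𝒜 : ℕ → Submodule ℂ A) [GradedAlgebra 𝒜] :
    Proj 𝒜 ⟶ Spec (CommRingCat.of ℂ) :=
  Proj.toSpecZero 𝒜 ≫ Spec.map (CommRingCat.ofHom (algebraMap ℂ (𝒜 0)))

lemma awayι_comp_projStructure {i : ℕ} (hi : 0 < i) (s : A) (hs : s ∈ 𝒜 i) :
    Proj.awayι 𝒜 s hs hi ≫ projStructure 𝒜 = Spec.map (CommRingCat.ofHom
      ((HomogeneousLocalization.fromZeroRingHom 𝒜 (Submonoid.powers s)).comp
        (algebraMap ℂ (𝒜 0)))) := by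
  have := Proj.awayι_toSpecZero 𝒜 s hs hi
  rw [projStructure]
  rw [reassoc_of% this, ← Spec.map_comp, ← CommRingCat.ofHom_comp]

/-- On the chart where f s is invertible both composites come from ring maps out of ℂ, and these
agree because f fixes scalars. -/
lemma awayι_comp_projMap_comp_projStructure (f : 𝒜 →+*ᵍ ℬ) (hf : ℬ₊ ≤ 𝒜₊.map f)
    (hc : ∀ c : ℂ, f (algebraMap ℂ A c) = algebraMap ℂ B c) {i : ℕ} (hi : 0 < i) (s : A)
    (hs : s ∈ 𝒜 i) :
    Proj.awayι ℬ (f s) (f.2 hs) hi ≫ Proj.map f hf ≫ projStructure 𝒜 =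
      Proj.awayι ℬ (f s) (f.2 hs) hi ≫ projStructure ℬ := by
  have h := Proj.awayι_comp_map f hf hi s hs
  rw [← Category.assoc]
  refine (congrArg (· ≫ projStructure 𝒜) h).trans ?_
  rw [awayι_comp_projStructure, Category.assoc, awayι_comp_projStructure, ← Spec.map_comp,
    ← CommRingCat.ofHom_comp]
  congr 2
  refine RingHom.ext fun c => ?_
  refine (HomogeneousLocalization.map_mk f (by rintro _ ⟨n, rfl⟩; exact ⟨n, by simp⟩) _).trans ?_
  refine congrArg HomogeneousLocalization.mk ?_
  refine HomogeneousLocalization.NumDenSameDeg.ext _ rfl ?_ ?_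
  · exact hc c
  · exact map_one f

lemma projMap_comp_projStructure (f : 𝒜 →+*ᵍ ℬ) (hf : ℬ₊ ≤ 𝒜₊.map f)
    (hc : ∀ c : ℂ, f (algebraMap ℂ A c) = algebraMap ℂ B c) :
    Proj.map f hf ≫ projStructure 𝒜 = projStructure ℬ :=
  (Proj.mapAffineOpenCover f hf).openCover.hom_ext _ _ fun s =>
    awayι_comp_projMap_comp_projStructure f hf hc s.1.2 s.2.1 s.2.2

/-- An isomorphism of graded `ℂ`-algebras induces an isomorphism of `Proj` over `ℂ`. -/
theorem nonempty_projOver_iso (f : A ≃ₐ[ℂ] B) (hf : ∀ d, (𝒜 d).map f.toLinearMap = ℬ d) :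
    Nonempty (projOver 𝒜 ≅ projOver ℬ) := by
  have hf' : ∀ d, ∀ b ∈ ℬ d, f.symm b ∈ 𝒜 d := by
    intro d b hb
    rw [← hf] at hb
    obtain ⟨a, ha, rfl⟩ := hb
    simpa using ha
  let F : 𝒜 →+*ᵍ ℬ := ⟨f.toRingEquiv.toRingHom, fun {i x} hx => hf i ▸ ⟨x, hx, rfl⟩⟩
  let G : ℬ →+*ᵍ 𝒜 := ⟨f.symm.toRingEquiv.toRingHom, fun {i x} hx => hf' i x hx⟩
  have hF := irrelevant_le_map_of_surjective F fun d b hb => ⟨G b, G.2 hb, f.apply_symm_apply b⟩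
  have hG := irrelevant_le_map_of_surjective G fun d a ha => ⟨F a, F.2 ha, f.symm_apply_apply a⟩
  have hGF : G.comp F = .id 𝒜 := DFunLike.ext _ _ fun x => f.symm_apply_apply x
  have hFG : F.comp G = .id ℬ := DFunLike.ext _ _ fun x => f.apply_symm_apply x
  have h1 : Proj.map G hG ≫ Proj.map F hF = 𝟙 _ := by
    rw [← Proj.map_comp, ← Proj.map_id]
    congr 1
  have h2 : Proj.map F hF ≫ Proj.map G hG = 𝟙 _ := by
    rw [← Proj.map_comp, ← Proj.map_id]
    congr 1
  -- `Proj` is contravariant, so the inverse algebra map gives the forward morphism.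
  exact ⟨Over.isoMk ⟨Proj.map G hG, Proj.map F hF, h1, h2⟩
    (projMap_comp_projStructure G hG fun c => f.symm.commutes c)⟩

end ProjIso

lemma eval_leftSubst {m n : ℕ} (g : Matrix (Fin m) (Fin m) ℂ) (x : Fin m × Fin n → ℂ)
    (f : MvPolynomial (Fin m × Fin n) ℂ) :
    eval x (leftSubst n g f) = eval (fun p => ∑ i, g p.1 i * x (i, p.2)) f := by
  have h : (aeval x).comp (leftSubst n g) =
      aeval (R := ℂ) fun p : Fin m × Fin n => ∑ i, g p.1 i * x (i, p.2) :=
    MvPolynomial.algHom_ext fun p => by simp [leftSubst, aeval_eq_eval]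
  simpa [aeval_eq_eval] using DFunLike.congr_fun h f

/-! ### First fundamental theorem for SL₂. -/

section FirstFundamentalTheorem

variable {n : ℕ}

/-- The multidegree of a variable in the entries of a `2 × n` matrix. -/
abbrev colWeight (n : ℕ) : Fin 2 × Fin n → (Fin n → ℕ) := fun p => Pi.single p.2 1

lemma weight_colWeight_apply (d : Fin 2 × Fin n →₀ ℕ) (c : Fin n) :
    Finsupp.weight (colWeight n) d c = d (0, c) + d (1, c) := by
  rw [Finsupp.weight_apply, Finsupp.sum_fintype _ _ (by simp), Fintype.sum_prod_type]
  simp [Finset.sum_apply, Pi.single_apply]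

/-- Rescaling the columns multiplies a multihomogeneous polynomial by a monomial. -/
lemma aeval_mul_of_isWeightedHomogeneous {S : Type*} [CommRing S] [Algebra ℂ S] (s : Fin n → S)
    (x : Fin 2 × Fin n → S) {f : MvPolynomial (Fin 2 × Fin n) ℂ} {δ : Fin n → ℕ}
    (hf : IsWeightedHomogeneous (colWeight n) f δ) :
    aeval (fun p => s p.2 * x p) f = (∏ c, s c ^ δ c) * aeval x f := by
  induction hf using IsWeightedHomogeneous.induction_on with
  | zero => simp
  | add p q _ _ hp hq => rw [map_add, map_add, hp, hq, mul_add]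
  | monomial d r hr =>
    have h : (d.prod fun p k => s p.2 ^ k) = ∏ c, s c ^ δ c := by
      rw [Finsupp.prod_fintype _ _ (by simp), Fintype.prod_prod_type, Fin.prod_univ_two,
        ← Finset.prod_mul_distrib]
      refine Finset.prod_congr rfl fun c _ => ?_
      rw [← pow_add, ← hr, weight_colWeight_apply]
    rw [aeval_monomial, aeval_monomial, ← h]
    simp only [mul_pow, Finsupp.prod_mul]
    ring

lemma eval_mul_of_isWeightedHomogeneous (s : Fin n → ℂ) (x : Fin 2 × Fin n → ℂ)
    {f : MvPolynomial (Fin 2 × Fin n) ℂ} {δ : Fin n → ℕ}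
    (hf : IsWeightedHomogeneous (colWeight n) f δ) :
    eval (fun p => s p.2 * x p) f = (∏ c, s c ^ δ c) * eval x f := by
  simpa [aeval_eq_eval] using aeval_mul_of_isWeightedHomogeneous s x hf

/-- The `SL₂`-invariant polynomials of multidegree `δ` in the columns of a `2 × n` matrix. -/
def invariants (n : ℕ) (δ : Fin n → ℕ) : Submodule ℂ (MvPolynomial (Fin 2 × Fin n) ℂ) where
  carrier := {f | IsWeightedHomogeneous (colWeight n) f δ ∧
    ∀ g : Matrix.SpecialLinearGroup (Fin 2) ℂ, leftSubst n g.1 f = f}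
  zero_mem' := ⟨isWeightedHomogeneous_zero _ _ _, fun g => map_zero _⟩
  add_mem' := fun {f f'} hf hf' => ⟨hf.1.add hf'.1, fun g => by rw [map_add, hf.2 g, hf'.2 g]⟩
  smul_mem' := fun c f hf => ⟨(weightedHomogeneousSubmodule ℂ _ _).smul_mem c hf.1,
    fun g => by rw [map_smul, hf.2 g]⟩

lemma invariants_mul {δ δ' : Fin n → ℕ} {f f' : MvPolynomial (Fin 2 × Fin n) ℂ}
    (hf : f ∈ invariants n δ) (hf' : f' ∈ invariants n δ') : f * f' ∈ invariants n (δ + δ') :=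
  ⟨hf.1.mul hf'.1, fun g => by rw [map_mul, hf.2 g, hf'.2 g]⟩

lemma one_mem_invariants : (1 : MvPolynomial (Fin 2 × Fin n) ℂ) ∈ invariants n 0 :=
  ⟨isWeightedHomogeneous_one _ _, fun _ => map_one _⟩

/-- The bracket `[a b]`: the minor of the generic `2 × n` matrix in the columns `a` and `b`. -/
def bracket (a b : Fin n) : MvPolynomial (Fin 2 × Fin n) ℂ :=
  X (0, a) * X (1, b) - X (0, b) * X (1, a)

lemma bracket_swap (a b : Fin n) : bracket b a = -bracket a b := by
  simp only [bracket]; ring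

lemma bracket_plucker (a b c d : Fin n) :
    bracket a b * bracket c d = bracket a c * bracket b d - bracket a d * bracket b c := by
  simp only [bracket]; ring

lemma leftSubst_bracket (g : Matrix (Fin 2) (Fin 2) ℂ) (a b : Fin n) :
    leftSubst n g (bracket a b) = C g.det * bracket a b := by
  simp only [leftSubst, bracket, map_sub, map_mul, aeval_X, Fin.sum_univ_two, Matrix.det_fin_two]
  ring

lemma bracket_mem_invariants (a b : Fin n) :
    bracket a b ∈ invariants n (Pi.single a 1 + Pi.single b 1) := by
  refine ⟨?_, fun g => by rw [leftSubst_bracket, g.2, C_1, one_mul]⟩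
  have h : ∀ p : Fin 2 × Fin n, IsWeightedHomogeneous (colWeight n) (X p : MvPolynomial _ ℂ)
    (Pi.single p.2 1) := fun p => isWeightedHomogeneous_X _ _ p
  refine ((h (0, a)).mul (h (1, b))).sub ?_
  rw [add_comm]
  exact (h (0, b)).mul (h (1, a))

lemma not_X_dvd_bracket {a b : Fin n} (hab : a ≠ b) : ¬ X (0, a) ∣ bracket a b := by
  rintro ⟨q, hq⟩
  have := congrArg (eval fun p : Fin 2 × Fin n => if p = (0, a) then 0 else 1) hq
  simp [bracket, hab.symm] at this

lemma bracket_ne_zero {a b : Fin n} (hab : a ≠ b) : bracket a b ≠ 0 :=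
  fun h => not_X_dvd_bracket hab (h ▸ dvd_zero _)

/-- The bracket monomial of a multigraph. -/
def bracketMonomial (E : Multiset (Fin n × Fin n)) : MvPolynomial (Fin 2 × Fin n) ℂ :=
  (E.map fun e => bracket e.1 e.2).prod

/-- The vertex degrees of a multigraph. -/
def multidegree (E : Multiset (Fin n × Fin n)) : Fin n → ℕ :=
  (E.map fun e => Pi.single e.1 1 + Pi.single e.2 1).sum

@[simp] lemma bracketMonomial_zero : bracketMonomial (0 : Multiset (Fin n × Fin n)) = 1 := rfl

@[simp] lemma bracketMonomial_cons (e : Fin n × Fin n) (E : Multiset (Fin n × Fin n)) :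
    bracketMonomial (e ::ₘ E) = bracket e.1 e.2 * bracketMonomial E := by simp [bracketMonomial]

lemma bracketMonomial_add (E E' : Multiset (Fin n × Fin n)) :
    bracketMonomial (E + E') = bracketMonomial E * bracketMonomial E' := by simp [bracketMonomial]

@[simp] lemma multidegree_zero : multidegree (0 : Multiset (Fin n × Fin n)) = 0 := rfl

@[simp] lemma multidegree_cons (e : Fin n × Fin n) (E : Multiset (Fin n × Fin n)) :
    multidegree (e ::ₘ E) = Pi.single e.1 1 + Pi.single e.2 1 + multidegree E := by
  simp [multidegree]

lemma multidegree_add (E E' : Multiset (Fin n × Fin n)) :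
    multidegree (E + E') = multidegree E + multidegree E' := by simp [multidegree]

lemma bracketMonomial_mem_invariants (E : Multiset (Fin n × Fin n)) :
    bracketMonomial E ∈ invariants n (multidegree E) := by
  induction E using Multiset.induction_on with
  | empty => exact one_mem_invariants
  | cons e E ih =>
    rw [bracketMonomial_cons, multidegree_cons]
    exact invariants_mul (bracket_mem_invariants _ _) ih

/-- The span of the bracket monomials of multidegree `δ`. -/
def bracketSpan (δ : Fin n → ℕ) : Submodule ℂ (MvPolynomial (Fin 2 × Fin n) ℂ) :=
  Submodule.span ℂ (bracketMonomial '' {E | multidegree E = δ})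

lemma bracketSpan_le_invariants (δ : Fin n → ℕ) : bracketSpan δ ≤ invariants n δ :=
  Submodule.span_le.mpr (by rintro _ ⟨E, rfl, rfl⟩; exact bracketMonomial_mem_invariants E)

/-! Identification of columns. -/

/-- The push-forward of a multidegree along a map of the columns. -/
def pushDegree (r : Fin n → Fin n) : (Fin n → ℕ) →+ (Fin n → ℕ) where
  toFun δ := ∑ c, δ c • Pi.single (r c) 1
  map_zero' := by simp
  map_add' δ δ' := by simp [add_smul, Finset.sum_add_distrib]

lemma pushDegree_apply (r : Fin n → Fin n) (δ : Fin n → ℕ) (c : Fin n) :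
    pushDegree r δ c = ∑ c', if c = r c' then δ c' else 0 := by
  simp [pushDegree, Finset.sum_apply, Pi.single_apply]

lemma pushDegree_single (r : Fin n → Fin n) (a : Fin n) :
    pushDegree r (Pi.single a 1) = Pi.single (r a) 1 := by
  ext c
  rw [pushDegree_apply, Finset.sum_eq_single a]
  · simp [Pi.single_apply]
  · intro b _ hb; simp [hb]
  · simp

lemma sum_pushDegree (r : Fin n → Fin n) (δ : Fin n → ℕ) : ∑ c, pushDegree r δ c = ∑ c, δ c := by
  simp only [pushDegree_apply]
  rw [Finset.sum_comm]
  simp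

/-- Substituting the `r c`-th column for the `c`-th one. -/
def mergeColumns (r : Fin n → Fin n) :
    MvPolynomial (Fin 2 × Fin n) ℂ →ₐ[ℂ] MvPolynomial (Fin 2 × Fin n) ℂ :=
  rename fun p => (p.1, r p.2)

lemma mergeColumns_bracket (r : Fin n → Fin n) (a b : Fin n) :
    mergeColumns r (bracket a b) = bracket (r a) (r b) := by
  simp [mergeColumns, bracket]

lemma mergeColumns_apply (r : Fin n → Fin n) (f : MvPolynomial (Fin 2 × Fin n) ℂ) :
    mergeColumns r f = aeval (fun p => X (p.1, r p.2)) f := by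
  refine DFunLike.congr_fun (MvPolynomial.algHom_ext fun p => ?_) f
  simp [mergeColumns]

lemma weight_mapDomain (r : Fin n → Fin n) (d : Fin 2 × Fin n →₀ ℕ) :
    Finsupp.weight (colWeight n) (d.mapDomain fun p => (p.1, r p.2)) =
      pushDegree r (Finsupp.weight (colWeight n) d) := by
  induction d using Finsupp.induction_linear with
  | zero => simp
  | add d d' h h' => rw [Finsupp.mapDomain_add, map_add, map_add, map_add, h, h']
  | single p k =>
    rw [Finsupp.mapDomain_single, Finsupp.weight_single, Finsupp.weight_single, map_nsmul,
      pushDegree_single]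

lemma mergeColumns_mem_invariants (r : Fin n → Fin n) {δ : Fin n → ℕ}
    {f : MvPolynomial (Fin 2 × Fin n) ℂ} (hf : f ∈ invariants n δ) :
    mergeColumns r f ∈ invariants n (pushDegree r δ) := by
  refine ⟨?_, fun g => ?_⟩
  · obtain ⟨hf, -⟩ := hf
    induction hf using IsWeightedHomogeneous.induction_on with
    | zero => rw [map_zero]; exact isWeightedHomogeneous_zero _ _ _
    | add p q _ _ hp hq => rw [map_add]; exact hp.add hq
    | monomial d a hd =>
      rw [mergeColumns, rename_monomial]
      refine isWeightedHomogeneous_monomial _ _ _ ?_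
      rw [weight_mapDomain, hd]
  · conv_rhs => rw [← hf.2 g]
    rw [← AlgHom.comp_apply, ← AlgHom.comp_apply]
    congr 1
    refine MvPolynomial.algHom_ext fun p => ?_
    simp [leftSubst, mergeColumns]

/-- One edge endpoint at a merged vertex is handed back to some original vertex with degree to
spare; this is the inductive step for lifting multigraphs. -/
lemma exists_of_pushDegree_eq_single_add (r : Fin n → Fin n) {δ ε : Fin n → ℕ} {i : Fin n}
    (h : pushDegree r δ = Pi.single i 1 + ε) :
    ∃ i' δ', r i' = i ∧ δ = Pi.single i' 1 + δ' ∧ pushDegree r δ' = ε := by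
  have h1 : pushDegree r δ i ≠ 0 := by rw [h]; simp
  rw [pushDegree_apply] at h1
  obtain ⟨i', -, hi'⟩ := Finset.exists_ne_zero_of_sum_ne_zero h1
  have hi : i = r i' := by by_contra h; simp [h] at hi'
  rw [if_pos hi] at hi'
  have h2 : δ = Pi.single i' 1 + (δ - Pi.single i' 1) := by
    ext c
    by_cases hc : c = i'
    · subst hc; simp; omega
    · simp [hc]
  refine ⟨i', δ - Pi.single i' 1, hi.symm, h2, ?_⟩
  rw [h2, map_add, pushDegree_single, ← hi] at h
  exact add_left_cancel h

/-- Bracket monomials lift along the identification of columns. -/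
lemma exists_bracketMonomial_lift (r : Fin n → Fin n) (E : Multiset (Fin n × Fin n))
    (δ : Fin n → ℕ) (h : pushDegree r δ = multidegree E) :
    ∃ E', multidegree E' = δ ∧ mergeColumns r (bracketMonomial E') = bracketMonomial E := by
  induction E using Multiset.induction_on generalizing δ with
  | empty =>
    refine ⟨0, ?_, by simp⟩
    have h0 := sum_pushDegree r δ
    rw [h] at h0
    ext c
    simp only [multidegree_zero, Pi.zero_apply, Finset.sum_const_zero] at h0 ⊢
    exact (Finset.sum_eq_zero_iff.mp h0.symm c (Finset.mem_univ c)).symm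
  | cons e E ih =>
    rw [multidegree_cons, add_assoc] at h
    obtain ⟨i, δ₁, hi, rfl, h1⟩ := exists_of_pushDegree_eq_single_add r h
    obtain ⟨j, δ₂, hj, rfl, h2⟩ := exists_of_pushDegree_eq_single_add r h1
    obtain ⟨E', rfl, hE'⟩ := ih δ₂ h2
    refine ⟨(i, j) ::ₘ E', by simp [add_assoc], ?_⟩
    rw [bracketMonomial_cons, bracketMonomial_cons, map_mul, mergeColumns_bracket, hi, hj, hE']

lemma bracketSpan_le_map_mergeColumns (r : Fin n → Fin n) (δ : Fin n → ℕ) :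
    bracketSpan (pushDegree r δ) ≤ (bracketSpan δ).map (mergeColumns r).toLinearMap := by
  refine Submodule.span_le.mpr ?_
  rintro _ ⟨E, hE, rfl⟩
  obtain ⟨E', hE', h⟩ := exists_bracketMonomial_lift r E δ hE.symm
  exact ⟨_, Submodule.subset_span ⟨E', hE', rfl⟩, h⟩

/-- Modulo [a b], the column b scaled by x₀ₐ equals the column a scaled by x₀_b. By homogeneity in
column b, x₀ₐ^δ_b · f is then congruent to a multiple of f with b replaced by a, which is zero. The
prime x₀ₐ does not divide [a b], so its power can be cancelled. -/
lemma bracket_dvd_of_mergeColumns_eq_zero {a b : Fin n} (hab : a ≠ b) {δ : Fin n → ℕ}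
    {f : MvPolynomial (Fin 2 × Fin n) ℂ} (hf : IsWeightedHomogeneous (colWeight n) f δ)
    (h : mergeColumns (Function.update id b a) f = 0) : bracket a b ∣ f := by
  have h1 := aeval_mul_of_isWeightedHomogeneous
    (Function.update (1 : Fin n → MvPolynomial (Fin 2 × Fin n) ℂ) b (X (0, a))) X hf
  have h2 := aeval_mul_of_isWeightedHomogeneous
    (Function.update (1 : Fin n → MvPolynomial (Fin 2 × Fin n) ℂ) b (X (0, b)))
    (fun p => X (p.1, Function.update id b a p.2)) hf
  rw [← mergeColumns_apply, h, mul_zero] at h2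
  rw [aeval_X_left, AlgHom.id_apply, Finset.prod_eq_single b (by
    intro c _ hc; simp [hc]) (by simp), Function.update_self] at h1
  have h4 : bracket a b ∣ X (0, a) ^ δ b * f := by
    have h5 := DFunLike.congr_fun (MvPolynomial.algHom_ext (fun p => ?_) :
      (Ideal.Quotient.mkₐ ℂ (Ideal.span {bracket a b})).comp (aeval fun p => Function.update
        (1 : Fin n → MvPolynomial (Fin 2 × Fin n) ℂ) b (X (0, a)) p.2 * X p) =
      (Ideal.Quotient.mkₐ ℂ (Ideal.span {bracket a b})).comp (aeval fun p => Function.update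
        (1 : Fin n → MvPolynomial (Fin 2 × Fin n) ℂ) b (X (0, b)) p.2 *
          X (p.1, Function.update id b a p.2))) f
    · rw [AlgHom.comp_apply, AlgHom.comp_apply, h1, h2, map_zero, Ideal.Quotient.mkₐ_eq_mk,
        Ideal.Quotient.eq_zero_iff_mem, Ideal.mem_span_singleton] at h5
      exact h5
    obtain ⟨i, c⟩ := p
    simp only [AlgHom.comp_apply, aeval_X]
    by_cases hc : c = b
    · subst hc
      simp only [Function.update_self, Ideal.Quotient.mkₐ_eq_mk]
      rw [Ideal.Quotient.eq, Ideal.mem_span_singleton]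
      fin_cases i
      · exact ⟨0, by simp; ring⟩
      · exact ⟨1, by simp [bracket]⟩
    · simp [hc]
  obtain ⟨q, hq⟩ := h4
  obtain ⟨q', rfl⟩ := X_prime.pow_dvd_of_dvd_mul_left _ (not_X_dvd_bracket hab)
    (Dvd.intro _ hq)
  refine ⟨q', mul_left_cancel₀ (pow_ne_zero (δ b) (X_ne_zero (0, a))) ?_⟩
  rw [hq]; ring

/-- The polynomial ring is a domain: cancelling the bracket shows both that h equals its component
of degree δ and that it is invariant. -/
lemma mem_invariants_of_bracket_mul {a b : Fin n} (hab : a ≠ b) {δ : Fin n → ℕ}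
    {h : MvPolynomial (Fin 2 × Fin n) ℂ}
    (hf : bracket a b * h ∈ invariants n (Pi.single a 1 + Pi.single b 1 + δ)) :
    h ∈ invariants n δ := by
  refine ⟨?_, fun g => mul_left_cancel₀ (bracket_ne_zero hab) ?_⟩
  · let _ := weightedGradedAlgebra ℂ (colWeight n)
    have h1 := DirectSum.coe_decompose_mul_add_of_left_mem
      (weightedHomogeneousSubmodule ℂ (colWeight n)) (b := h) (j := δ)
      (bracket_mem_invariants a b).1
    rw [DirectSum.decompose_of_mem_same (weightedHomogeneousSubmodule ℂ (colWeight n)) hf.1] at h1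
    rw [mul_left_cancel₀ (bracket_ne_zero hab) h1]
    exact (DirectSum.decompose (weightedHomogeneousSubmodule ℂ (colWeight n)) h δ).2
  · have h1 := hf.2 g
    rwa [map_mul, (bracket_mem_invariants a b).2 g] at h1

/-- Such an f depends on one column only, and SL₂ contains an element that doubles a given vector;
invariance gives f = 2^k f. The factor x₀ₐ disposes of the points where the explicit element is
undefined. -/
lemma eq_zero_of_mem_invariants_single {a : Fin n} {k : ℕ} (hk : k ≠ 0)
    {f : MvPolynomial (Fin 2 × Fin n) ℂ} (hf : f ∈ invariants n (Pi.single a k)) : f = 0 := by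
  suffices h : X (0, a) * f = 0 from (mul_eq_zero.mp h).resolve_left (X_ne_zero _)
  refine MvPolynomial.funext fun x => ?_
  rw [map_mul, eval_X, map_zero]
  by_cases hx : x (0, a) = 0
  · rw [hx, zero_mul]
  rw [mul_eq_zero, or_iff_right hx]
  have hprod : ∀ t : ℂ, ∏ c, (Pi.single a t : Fin n → ℂ) c ^ (Pi.single a k : Fin n → ℕ) c
      = t ^ k := by
    intro t
    rw [Finset.prod_eq_single a (by intro c _ hc; simp [hc]) (by simp)]
    simp
  -- Lower triangular of determinant 1, with column a of x as an eigenvector of eigenvalue 2.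
  let g : Matrix.SpecialLinearGroup (Fin 2) ℂ :=
    ⟨!![2, 0; 3 * x (1, a) / (2 * x (0, a)), 1 / 2], by simp [Matrix.det_fin_two_of]⟩
  let y : Fin 2 × Fin n → ℂ := fun p => ∑ i, g.1 p.1 i * x (i, p.2)
  have h1 : eval y f = eval x f := by
    conv_rhs => rw [← hf.2 g]
    rw [eval_leftSubst]
  have h2 := eval_mul_of_isWeightedHomogeneous (Pi.single a 1) y hf.1
  have h3 := eval_mul_of_isWeightedHomogeneous (Pi.single a 2) x hf.1
  have h4 : (fun p : Fin 2 × Fin n => (Pi.single a 1 : Fin n → ℂ) p.2 * y p) =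
      fun p => (Pi.single a 2 : Fin n → ℂ) p.2 * x p := by
    ext ⟨i, c⟩
    by_cases hc : c = a
    · subst hc
      fin_cases i
      · simp [y, g]
      · simp [y, g]; field_simp; ring
    · simp [hc]
  rw [hprod] at h2 h3
  rw [h4, h3, h1, one_pow, one_mul] at h2
  have h5 : (2 : ℂ) ^ k - 1 ≠ 0 := by
    rw [sub_ne_zero]
    have : (2 : ℕ) ^ k ≠ 1 := by simp [hk]
    exact_mod_cast this
  refine (mul_eq_zero.mp ?_).resolve_left h5
  rw [sub_mul, h2, one_mul, sub_self]

/-- The first fundamental theorem of invariant theory for `SL₂`: the invariants of a given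
multidegree are spanned by the bracket monomials. -/
theorem invariants_eq_bracketSpan (δ : Fin n → ℕ) : invariants n δ = bracketSpan δ := by
  refine le_antisymm ?_ (bracketSpan_le_invariants δ)
  -- Induction on total degree plus number of columns in use: merging two columns lowers the second
  -- term, dividing by a bracket lowers the first, and neither raises the other.
  obtain ⟨m, hm⟩ : ∃ m, m = ∑ c, δ c + (Finset.univ.filter fun c => δ c ≠ 0).card := ⟨_, rfl⟩
  induction m using Nat.strong_induction_on generalizing δ with
  | _ m ih =>
  intro f hf
  by_cases hδ : ∃ a b, a ≠ b ∧ δ a ≠ 0 ∧ δ b ≠ 0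
  · obtain ⟨a, b, hab, ha, hb⟩ := hδ
    set r : Fin n → Fin n := Function.update id b a with hr
    have h1 : mergeColumns r f ∈ bracketSpan (pushDegree r δ) := by
      refine ih _ ?_ _ rfl (mergeColumns_mem_invariants r hf)
      rw [hm, sum_pushDegree]
      refine Nat.add_lt_add_left (Finset.card_lt_card ?_) _
      refine (Finset.ssubset_iff_of_subset fun c hc => ?_).mpr ⟨b, by simpa using hb, ?_⟩
      · simp only [Finset.mem_filter_univ, pushDegree_apply] at hc ⊢
        obtain ⟨c', -, hc'⟩ := Finset.exists_ne_zero_of_sum_ne_zero hc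
        have hc1 : c = r c' := by by_contra h; simp [h] at hc'
        rw [if_pos hc1] at hc'
        by_cases h : c' = b
        · subst h; rw [hc1, hr, Function.update_self]; exact ha
        · rw [hr, Function.update_of_ne h] at hc1
          rw [hc1]; exact hc'
      · simp only [Finset.mem_filter_univ, pushDegree_apply, not_not]
        refine Finset.sum_eq_zero fun c _ => if_neg fun h => ?_
        by_cases hc : c = b
        · subst hc; rw [hr, Function.update_self] at h; exact hab h.symm
        · rw [hr, Function.update_of_ne hc] at h; exact hc h.symm
    -- Subtracting a lift of the merged polynomial leaves an invariant that vanishes after merging,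
    -- hence a multiple of [a b].
    obtain ⟨f₁, hf₁, hf₁'⟩ := bracketSpan_le_map_mergeColumns r δ h1
    have h2 : f - f₁ ∈ invariants n δ := sub_mem hf (bracketSpan_le_invariants δ hf₁)
    obtain ⟨q, hq⟩ := bracket_dvd_of_mergeColumns_eq_zero hab h2.1
      (by rw [map_sub, sub_eq_zero]; exact hf₁'.symm)
    obtain ⟨δ', rfl⟩ : ∃ δ', δ = Pi.single a 1 + Pi.single b 1 + δ' := by
      refine ⟨δ - (Pi.single a 1 + Pi.single b 1), ?_⟩
      ext c
      by_cases hca : c = a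
      · subst hca; simp [hab]; omega
      · by_cases hcb : c = b
        · subst hcb; simp [hab.symm]; omega
        · simp [hca, hcb]
    rw [hq] at h2
    have h3 : q ∈ bracketSpan δ' := by
      refine ih _ ?_ _ rfl (mem_invariants_of_bracket_mul hab h2)
      rw [hm]
      have : (Finset.univ.filter fun c => δ' c ≠ 0).card ≤ (Finset.univ.filter fun c =>
          (Pi.single a 1 + Pi.single b 1 + δ' : Fin n → ℕ) c ≠ 0).card :=
        Finset.card_le_card fun c hc => by
          simp only [Finset.mem_filter_univ, Pi.add_apply] at hc ⊢; omega
      refine add_lt_add_of_lt_of_le ?_ this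
      simp [Finset.sum_add_distrib]
    rw [← sub_add_cancel f f₁, hq]
    refine add_mem ?_ hf₁
    clear hq h2 hf₁ hf₁' h1
    induction h3 using Submodule.span_induction with
    | mem q hq =>
      obtain ⟨E, hE, rfl⟩ := hq
      exact Submodule.subset_span ⟨(a, b) ::ₘ E, by
        simp only [Set.mem_ofPred_eq] at hE; simp [hE], by simp⟩
    | zero => rw [mul_zero]; exact zero_mem _
    | add _ _ _ _ h h' => rw [mul_add]; exact add_mem h h'
    | smul c _ _ h => rw [mul_smul_comm]; exact Submodule.smul_mem _ _ h
  · push Not at hδ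
    by_cases h0 : δ = 0
    · subst h0
      -- In multidegree zero, scaling all columns by 0 does not change f, so f is constant.
      have h1 := aeval_mul_of_isWeightedHomogeneous (0 : Fin n → MvPolynomial (Fin 2 × Fin n) ℂ)
        X hf.1
      simp only [Pi.zero_apply, zero_mul, pow_zero, Finset.prod_const_one, one_mul, aeval_X_left,
        AlgHom.id_apply] at h1
      rw [← h1]
      have h2 : aeval (fun _ : Fin 2 × Fin n => (0 : MvPolynomial (Fin 2 × Fin n) ℂ)) f =
          constantCoeff f • bracketMonomial 0 := by
        rw [aeval_zero', bracketMonomial_zero, Algebra.smul_def, mul_one]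
      rw [h2]
      exact Submodule.smul_mem _ _ (Submodule.subset_span ⟨0, rfl, rfl⟩)
    · obtain ⟨a, ha⟩ := Function.ne_iff.mp h0
      have h1 : δ = Pi.single a (δ a) := by
        ext c
        by_cases hc : c = a
        · subst hc; simp
        · simpa [hc] using hδ a c (Ne.symm hc) ha
      rw [h1] at hf
      rw [eq_zero_of_mem_invariants_single ha hf]
      exact zero_mem _

end FirstFundamentalTheorem

/-! ### Kempe's theorem: generation of the invariants in degree one. -/

section Kempe

variable {n : ℕ}

lemma multidegree_apply (E : Multiset (Fin n × Fin n)) (c : Fin n) :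
    multidegree E c = (E.map fun e => (Pi.single e.1 1 + Pi.single e.2 1 : Fin n → ℕ) c).sum := by
  induction E using Multiset.induction_on with
  | empty => simp
  | cons e E ih => simp [ih]

lemma sum_mul_multidegree (s : Fin n → ℤ) (E : Multiset (Fin n × Fin n)) :
    ∑ c, s c * multidegree E c = (E.map fun e => s e.1 + s e.2).sum := by
  induction E using Multiset.induction_on with
  | empty => simp
  | cons e E ih =>
    simp [mul_add, Finset.sum_add_distrib, ih, Pi.single_apply]

/-- Reduction to bipartite multigraphs: if the vertices in `P` and those outside `P` have the same
total degree, a bracket monomial is a combination of monomials whose edges all join `P` to its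
complement. -/
lemma bracketMonomial_mem_span_bipartite (P : Fin n → Prop) [DecidablePred P]
    (E : Multiset (Fin n × Fin n))
    (hE : ∑ c, (if P c then 1 else -1 : ℤ) * multidegree E c = 0) :
    bracketMonomial E ∈ Submodule.span ℂ (bracketMonomial ''
      {E' | multidegree E' = multidegree E ∧ ∀ e ∈ E', P e.1 ∧ ¬ P e.2}) := by
  obtain ⟨k, hk⟩ : ∃ k, k = E.countP fun e => P e.1 ∧ P e.2 := ⟨_, rfl⟩
  induction k using Nat.strong_induction_on generalizing E with
  | _ k ih =>
  -- Crossing edges cancel in the signed degree sum, so balance forces as many edges inside `P` as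
  -- inside its complement.
  have hbal : ∀ F : Multiset (Fin n × Fin n),
      (F.map fun e => (if P e.1 then 1 else -1 : ℤ) + (if P e.2 then 1 else -1)).sum =
        2 * (F.countP fun e => P e.1 ∧ P e.2) - 2 * (F.countP fun e => ¬ P e.1 ∧ ¬ P e.2) := by
    intro F
    induction F using Multiset.induction_on with
    | empty => simp
    | cons e F ihF =>
      rw [Multiset.map_cons, Multiset.sum_cons, ihF, Multiset.countP_cons, Multiset.countP_cons]
      by_cases h1 : P e.1 <;> by_cases h2 : P e.2 <;> simp [h1, h2] <;> ring
  have hcount : E.countP (fun e => P e.1 ∧ P e.2) = E.countP fun e => ¬ P e.1 ∧ ¬ P e.2 := by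
    have := hbal E
    rw [← sum_mul_multidegree (fun c => if P c then 1 else -1), hE] at this
    omega
  by_cases hk0 : k = 0
  · have h1 := hk.symm.trans hk0
    have h2 := hcount.symm.trans h1
    rw [Multiset.countP_eq_zero] at h1 h2
    -- With only crossing edges left, orienting them all out of `P` costs a sign.
    let o : Fin n × Fin n → Fin n × Fin n := fun e => if P e.1 then e else e.swap
    have h3 : ∀ F : Multiset (Fin n × Fin n), ∃ c : ℂ,
        bracketMonomial F = c • bracketMonomial (F.map o) := by
      intro F
      induction F using Multiset.induction_on with
      | empty => exact ⟨1, by simp⟩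
      | cons e F ihF =>
        obtain ⟨c, hc⟩ := ihF
        by_cases he : P e.1
        · exact ⟨c, by simp [hc, o, he]⟩
        · refine ⟨-c, ?_⟩
          rw [Multiset.map_cons, bracketMonomial_cons, bracketMonomial_cons, hc]
          simp only [o, if_neg he, Prod.fst_swap, Prod.snd_swap]
          rw [bracket_swap e.1 e.2]
          simp
    obtain ⟨c, hc⟩ := h3 E
    rw [hc]
    refine Submodule.smul_mem _ _ (Submodule.subset_span ⟨E.map o, ⟨?_, ?_⟩, rfl⟩)
    · simp only [multidegree, Multiset.map_map]
      congr 1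
      refine Multiset.map_congr rfl fun e _ => ?_
      by_cases he : P e.1
      · simp [o, he]
      · simp [o, he, add_comm]
    · intro e he
      obtain ⟨e, he', rfl⟩ := Multiset.mem_map.mp he
      have h4 := h1 e he'
      have h5 := h2 e he'
      by_cases h6 : P e.1
      · simp only [o, if_pos h6]; tauto
      · simp only [o, if_neg h6, Prod.fst_swap, Prod.snd_swap]; tauto
  · have hpos : 0 < E.countP fun e => P e.1 ∧ P e.2 := by omega
    have hneg : 0 < E.countP fun e => ¬ P e.1 ∧ ¬ P e.2 := by omega
    obtain ⟨⟨a, b⟩, hab, ha, hb⟩ := Multiset.countP_pos.mp hpos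
    obtain ⟨⟨c, d⟩, hcd, hc, hd⟩ := Multiset.countP_pos.mp hneg
    simp only at ha hb hc hd
    obtain ⟨E₁, rfl⟩ := Multiset.exists_cons_of_mem hab
    have hcd' : (c, d) ∈ E₁ := by
      rcases Multiset.mem_cons.mp hcd with h | h
      · rw [Prod.mk.injEq] at h
        exact absurd (h.1 ▸ ha) hc
      · exact h
    obtain ⟨E', rfl⟩ := Multiset.exists_cons_of_mem hcd'
    -- The Plücker relation replaces one edge inside `P` and one inside the complement by two
    -- crossing edges, in two ways; each result has one inner edge of `P` fewer.
    have key : ∀ u v w x : Fin n, P u → ¬ P v → P w → ¬ P x →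
        multidegree ((u, v) ::ₘ (w, x) ::ₘ E') = multidegree ((a, b) ::ₘ (c, d) ::ₘ E') →
        bracketMonomial ((u, v) ::ₘ (w, x) ::ₘ E') ∈ Submodule.span ℂ (bracketMonomial ''
          {F | multidegree F = multidegree ((a, b) ::ₘ (c, d) ::ₘ E') ∧
            ∀ e ∈ F, P e.1 ∧ ¬ P e.2}) := by
      intro u v w x hu hv hw hx hdeg
      have := ih _ ?_ ((u, v) ::ₘ (w, x) ::ₘ E') (by rw [hdeg]; exact hE) rfl
      · rwa [hdeg] at this
      · rw [hk]
        simp [ha, hb, hv, hx, hc]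
    have h1 := key a c b d ha hc hb hd (by simp only [multidegree_cons]; abel)
    have h2 := key a d b c ha hd hb hc (by simp only [multidegree_cons]; abel)
    have h3 : bracketMonomial ((a, b) ::ₘ (c, d) ::ₘ E') =
        bracketMonomial ((a, c) ::ₘ (b, d) ::ₘ E') - bracketMonomial ((a, d) ::ₘ (b, c) ::ₘ E') := by
      simp only [bracketMonomial_cons]
      rw [← mul_assoc, bracket_plucker]
      ring
    rw [h3]
    exact sub_mem h1 h2

variable {ℓ : ℕ}

/-- The perfect matching of the columns given by an ordering of them into pairs. -/
def matchingEdges (τ : Fin 2 × Fin ℓ ≃ Fin n) : Multiset (Fin n × Fin n) :=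
  (Finset.univ : Finset (Fin ℓ)).val.map fun j => (τ (0, j), τ (1, j))

/-- The product of the brackets of a perfect matching of the columns. -/
def matchingPoly (τ : Fin 2 × Fin ℓ ≃ Fin n) : MvPolynomial (Fin 2 × Fin n) ℂ :=
  ∏ j, bracket (τ (0, j)) (τ (1, j))

lemma bracketMonomial_matchingEdges (τ : Fin 2 × Fin ℓ ≃ Fin n) :
    bracketMonomial (matchingEdges τ) = matchingPoly τ := by
  rw [bracketMonomial, matchingEdges, Multiset.map_map]
  rfl

lemma multidegree_matchingEdges (τ : Fin 2 × Fin ℓ ≃ Fin n) :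
    multidegree (matchingEdges τ) = 1 := by
  have h : multidegree (matchingEdges τ) =
      ∑ j, (Pi.single (τ (0, j)) 1 + Pi.single (τ (1, j)) 1) := by
    rw [multidegree, matchingEdges, Multiset.map_map]
    rfl
  ext c
  rw [h, Finset.sum_add_distrib, Pi.add_apply, Finset.sum_apply, Finset.sum_apply,
    Pi.one_apply]
  have h2 : ∑ p : Fin 2 × Fin ℓ, (Pi.single (τ p) 1 : Fin n → ℕ) c = 1 := by
    rw [τ.sum_comp fun c' => (Pi.single c' 1 : Fin n → ℕ) c]
    simp [Pi.single_apply]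
  rwa [Fintype.sum_prod_type, Fin.sum_univ_two] at h2

/-- A regular bipartite multigraph of positive degree contains a perfect matching. -/
lemma exists_matchingEdges_le (τ₀ : Fin 2 × Fin ℓ ≃ Fin n) (E : Multiset (Fin n × Fin n)) {d : ℕ}
    (hd : 0 < d) (hE : multidegree E = fun _ => d)
    (hb : ∀ e ∈ E, (τ₀.symm e.1).1 = 0 ∧ ¬ (τ₀.symm e.2).1 = 0) :
    ∃ τ : Fin 2 × Fin ℓ ≃ Fin n, matchingEdges τ ≤ E := by
  have hsum : ∀ (k : Fin 2) (S : Finset (Fin ℓ)), d * S.card = (E.map fun e =>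
      ∑ i ∈ S, (Pi.single e.1 1 + Pi.single e.2 1 : Fin n → ℕ) (τ₀ (k, i))).sum := by
    intro k S
    rw [Multiset.sum_map_sum]
    simp only [← multidegree_apply, hE, Finset.sum_const, smul_eq_mul, mul_comm]
  -- Hall's condition by double counting: the d·|S| edges at `S` all end in its neighbourhood, which
  -- meets only d times its size.
  have hall : ∀ S : Finset (Fin ℓ), S.card ≤
      (S.biUnion fun i => Finset.univ.filter fun j => (τ₀ (0, i), τ₀ (1, j)) ∈ E).card := by
    intro S
    refine Nat.le_of_mul_le_mul_left ?_ hd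
    rw [hsum 0, hsum 1]
    refine Multiset.sum_map_le_sum_map _ _ fun e he => ?_
    obtain ⟨⟨p, hp⟩, q, hq⟩ : (∃ p, e.1 = τ₀ (0, p)) ∧ ∃ q, e.2 = τ₀ (1, q) := by
      obtain ⟨h1, h2⟩ := hb e he
      have h2 : (τ₀.symm e.2).1 = 1 := by omega
      exact ⟨⟨(τ₀.symm e.1).2, by rw [← h1, Prod.mk.eta, Equiv.apply_symm_apply]⟩,
        ⟨(τ₀.symm e.2).2, by rw [← h2, Prod.mk.eta, Equiv.apply_symm_apply]⟩⟩
    have hpq : (τ₀ (0, p), τ₀ (1, q)) ∈ E := by rw [← hp, ← hq]; exact he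
    simp only [Pi.add_apply, hp, hq, Pi.single_apply, EmbeddingLike.apply_eq_iff_eq, Prod.mk.injEq,
      Finset.sum_add_distrib]
    by_cases hpS : p ∈ S
    · have : ∃ i ∈ S, (τ₀ (0, i), τ₀ (1, q)) ∈ E := ⟨p, hpS, hpq⟩
      simp [hpS, this]
    · simp [hpS]
  obtain ⟨f, hf, hfE⟩ := (Finset.all_card_le_biUnion_card_iff_exists_injective _).mp hall
  let σ : Equiv.Perm (Fin ℓ) := Equiv.ofBijective f (Finite.injective_iff_bijective.mp hf)
  -- Keep the first endpoints and permute the second ones by the matching that Hall's theorem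
  -- provides.
  let τ : Fin 2 × Fin ℓ ≃ Fin n :=
    (Equiv.prodShear (Equiv.refl (Fin 2)) fun i => if i = 0 then 1 else σ).trans τ₀
  refine ⟨τ, (Multiset.le_iff_subset ?_).mpr ?_⟩
  · refine Finset.univ.nodup.map fun i j hij => ?_
    simpa using congrArg Prod.fst hij
  · intro e he
    obtain ⟨i, -, rfl⟩ := Multiset.mem_map.mp he
    have := hfE i
    simpa [τ, σ] using this

/-- Kempe's theorem: the invariants of degree `(d, …, d)` of an even number of points of the
projective line are spanned by the products of `d` matching polynomials. -/
theorem invariants_le_span_matchingPoly_pow (τ₀ : Fin 2 × Fin ℓ ≃ Fin n) (d : ℕ) :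
    invariants n (fun _ => d) ≤
      Submodule.span ℂ (Set.range (matchingPoly : (Fin 2 × Fin ℓ ≃ Fin n) → _)) ^ d := by
  rw [invariants_eq_bracketSpan]
  refine Submodule.span_le.mpr ?_
  rintro _ ⟨E, hE, rfl⟩
  rw [Set.mem_ofPred_eq] at hE
  -- The two halves have ℓ columns each, all of degree d.
  have hbal : ∑ c, (if (τ₀.symm c).1 = 0 then 1 else -1 : ℤ) * multidegree E c = 0 := by
    rw [hE, ← Finset.sum_mul, ← τ₀.sum_comp, Fintype.sum_prod_type]
    simp
  refine Submodule.span_le.mpr ?_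
    (bracketMonomial_mem_span_bipartite (fun c => (τ₀.symm c).1 = 0) E hbal)
  rintro _ ⟨F, ⟨hF, hFb⟩, rfl⟩
  rw [hE] at hF
  clear hbal hE E
  induction d generalizing F with
  | zero =>
    have : F = 0 := by
      rcases F.empty_or_exists_mem with h | ⟨e, he⟩
      · exact h
      · obtain ⟨F', rfl⟩ := Multiset.exists_cons_of_mem he
        have := congrFun hF e.1
        simp at this
    rw [this, pow_zero]
    exact Submodule.one_le.mp le_rfl
  | succ d ih =>
    obtain ⟨τ, hτ⟩ := exists_matchingEdges_le τ₀ F d.succ_pos hF hFb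
    obtain ⟨F', rfl⟩ := Multiset.le_iff_exists_add.mp hτ
    rw [bracketMonomial_add, bracketMonomial_matchingEdges, pow_succ']
    refine Submodule.mul_mem_mul (Submodule.subset_span ⟨τ, rfl⟩)
      (ih F' ?_ fun e he => hFb e (Multiset.mem_add.mpr (Or.inr he)))
    rw [multidegree_add, multidegree_matchingEdges] at hF
    ext c
    have := congrFun hF c
    simp only [Pi.add_apply, Pi.one_apply] at this
    omega

end Kempe

/-! ### Coefficients of the Segre determinant as invariants. -/

section SegreCoefficients

variable {ℓ : ℕ}

lemma segreDet_mul_left {R : Type*} [CommRing R] {k ℓ : ℕ} (g : Matrix (Fin k) (Fin k) R)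
    (A : Matrix (Fin k) (Fin (k * ℓ)) R) (B : Matrix (Fin ℓ) (Fin (k * ℓ)) R) :
    segreDet (g * A) B = g.det ^ ℓ * segreDet A B := by
  have h : segreMatrix (g * A) B = ((Matrix.kronecker g (1 : Matrix (Fin ℓ) (Fin ℓ) R)).submatrix
      finProdFinEquiv.symm finProdFinEquiv.symm) * segreMatrix A B := by
    ext1 r c
    rw [Matrix.mul_apply, ← finProdFinEquiv.sum_comp, Fintype.sum_prod_type]
    simp only [segreMatrix, Matrix.of_apply, Matrix.mul_apply, Matrix.submatrix_apply,
      Matrix.kronecker, Matrix.kroneckerMap_apply, Matrix.one_apply, Equiv.symm_apply_apply,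
      mul_ite, mul_one, mul_zero, ite_mul, zero_mul, Finset.sum_ite_eq, Finset.mem_univ, if_true,
      Finset.sum_mul, mul_assoc]
  rw [segreDet, segreDet, h, Matrix.det_mul, Matrix.det_submatrix_equiv_self, Matrix.kronecker,
    Matrix.det_kronecker]
  simp

lemma segreForm_mul_left {k ℓ : ℕ} (g : Matrix (Fin k) (Fin k) ℂ)
    (A : Matrix (Fin k) (Fin (k * ℓ)) ℂ) :
    segreForm (g * A) = g.det ^ ℓ • segreForm A := by
  rw [segreForm, Matrix.map_mul, segreDet_mul_left, ← RingHom.mapMatrix_apply, ← RingHom.map_det,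
    smul_eq_C_mul, C_pow]
  rfl

lemma eval_segreForm {k ℓ : ℕ} (A : Matrix (Fin k) (Fin (k * ℓ)) ℂ)
    (B : Matrix (Fin ℓ) (Fin (k * ℓ)) ℂ) :
    eval (fun p => B p.1 p.2) (segreForm A) = segreDet A B := by
  rw [segreForm, segreDet, RingHom.map_det, segreDet]
  congr 1
  ext1 r c
  simp [segreMatrix]

/-- The coefficient of the Segre determinant at a linear functional on polynomials in `B`, as a
polynomial in `A`. -/
def segreCoeff (ℓ : ℕ) : (MvPolynomial (Fin ℓ × Fin (2 * ℓ)) ℂ →ₗ[ℂ] ℂ) →ₗ[ℂ]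
    MvPolynomial (Fin 2 × Fin (2 * ℓ)) ℂ where
  -- Leibniz expansion: each permutation contributes a monomial in A, weighted by `L` of the
  -- accompanying monomial in B.
  toFun L := ∑ σ : Equiv.Perm (Fin (2 * ℓ)),
    C (Equiv.Perm.sign σ * L (∏ r, X ((finProdFinEquiv.symm (σ r)).2, r))) *
      ∏ r, X ((finProdFinEquiv.symm (σ r)).1, r)
  map_add' L L' := by
    simp [mul_add, add_mul, Finset.sum_add_distrib]
  map_smul' a L := by
    simp only [LinearMap.smul_apply, smul_eq_mul, Finset.smul_sum, smul_eq_C_mul, C_mul,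
      RingHom.id_apply]
    exact Finset.sum_congr rfl fun σ _ => by ring

lemma eval_segreCoeff (L : MvPolynomial (Fin ℓ × Fin (2 * ℓ)) ℂ →ₗ[ℂ] ℂ)
    (A : Matrix (Fin 2) (Fin (2 * ℓ)) ℂ) :
    eval (fun p => A p.1 p.2) (segreCoeff ℓ L) = L (segreForm A) := by
  rw [segreForm, segreDet, Matrix.det_apply, map_sum]
  simp only [segreCoeff, LinearMap.coe_mk, AddHom.coe_mk, map_sum]
  refine Finset.sum_congr rfl fun σ _ => ?_
  have h : ∏ r, segreMatrix (A.map C) (Matrix.of fun i j => X (i, j)) (σ r) r =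
      (∏ r, A (finProdFinEquiv.symm (σ r)).1 r) •
        ∏ r, (X ((finProdFinEquiv.symm (σ r)).2, r) : MvPolynomial (Fin ℓ × Fin (2 * ℓ)) ℂ) := by
    rw [smul_eq_C_mul, map_prod, ← Finset.prod_mul_distrib]
    rfl
  rw [h, map_mul, eval_C, map_prod (MvPolynomial.eval _), Units.smul_def, map_zsmul, map_smul]
  simp only [eval_X, zsmul_eq_mul, smul_eq_mul]
  ring

lemma isWeightedHomogeneous_segreCoeff (L : MvPolynomial (Fin ℓ × Fin (2 * ℓ)) ℂ →ₗ[ℂ] ℂ) :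
    IsWeightedHomogeneous (colWeight (2 * ℓ)) (segreCoeff ℓ L) 1 := by
  refine IsWeightedHomogeneous.sum _ _ _ fun σ _ => IsWeightedHomogeneous.C_mul ?_ _
  have h := IsWeightedHomogeneous.prod (w := colWeight (2 * ℓ)) Finset.univ
    (fun r => (X ((finProdFinEquiv.symm (σ r)).1, r) : MvPolynomial (Fin 2 × Fin (2 * ℓ)) ℂ))
    (fun r => Pi.single r 1) fun r _ => isWeightedHomogeneous_X _ _ _
  have h1 : ∑ r : Fin (2 * ℓ), (Pi.single r 1 : Fin (2 * ℓ) → ℕ) = 1 :=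
    Finset.univ_sum_single (1 : Fin (2 * ℓ) → ℕ)
  rwa [h1] at h

lemma segreCoeff_mem_invariants (L : MvPolynomial (Fin ℓ × Fin (2 * ℓ)) ℂ →ₗ[ℂ] ℂ) :
    segreCoeff ℓ L ∈ invariants (2 * ℓ) 1 := by
  refine ⟨isWeightedHomogeneous_segreCoeff L, fun g => MvPolynomial.funext fun x => ?_⟩
  let A : Matrix (Fin 2) (Fin (2 * ℓ)) ℂ := Matrix.of fun i c => x (i, c)
  have h1 := eval_segreCoeff L A
  have h2 := eval_segreCoeff L (g.1 * A)
  rw [segreForm_mul_left, g.2, one_pow, one_smul, ← h1] at h2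
  rw [eval_leftSubst]
  exact h2

/-- Every matching polynomial is a coefficient of the Segre determinant. -/
lemma matchingPoly_mem_range_segreCoeff (τ : Fin 2 × Fin ℓ ≃ Fin (2 * ℓ)) :
    matchingPoly τ ∈ LinearMap.range (segreCoeff ℓ) := by
  -- Column c of B is the basis vector indexed by the edge containing c, so reordering by `τ` makes
  -- the Segre matrix block diagonal. The sign of the reordering `ρ` is absorbed into the
  -- functional.
  let B : Matrix (Fin ℓ) (Fin (2 * ℓ)) ℂ := Matrix.of fun j c => if (τ.symm c).2 = j then 1 else 0
  let ρ : Equiv.Perm (Fin (2 * ℓ)) := finProdFinEquiv.symm.trans τ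
  refine ⟨(Equiv.Perm.sign ρ : ℂ) • (aeval fun p : Fin ℓ × Fin (2 * ℓ) => B p.1 p.2).toLinearMap,
    MvPolynomial.funext fun x => ?_⟩
  let A : Matrix (Fin 2) (Fin (2 * ℓ)) ℂ := Matrix.of fun i c => x (i, c)
  have h1 : eval x (segreCoeff ℓ ((Equiv.Perm.sign ρ : ℂ) •
      (aeval fun p : Fin ℓ × Fin (2 * ℓ) => B p.1 p.2).toLinearMap)) =
        Equiv.Perm.sign ρ * segreDet A B := by
    refine (eval_segreCoeff _ A).trans ?_
    rw [← eval_segreForm]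
    simp [aeval_eq_eval]
  have h2 : (segreMatrix A B).submatrix finProdFinEquiv τ =
      Matrix.blockDiagonal fun j => A.submatrix id fun i => τ (i, j) := by
    ext ⟨i, j⟩ ⟨i', j'⟩
    simp only [segreMatrix, B, Matrix.submatrix_apply, Matrix.of_apply,
      Equiv.symm_apply_apply, Matrix.blockDiagonal_apply, id, eq_comm (a := j)]
    by_cases hj : j' = j
    · subst hj; simp
    · simp [hj]
  have h3 : (segreMatrix A B).submatrix finProdFinEquiv τ =
      ((segreMatrix A B).submatrix id ρ).submatrix finProdFinEquiv finProdFinEquiv := by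
    ext p q
    simp [ρ]
  rw [h1, segreDet, ← Matrix.det_permute', ← Matrix.det_submatrix_equiv_self finProdFinEquiv,
    ← h3, h2, Matrix.det_blockDiagonal, matchingPoly, map_prod]
  refine Finset.prod_congr rfl fun j _ => ?_
  rw [Matrix.det_fin_two]
  simp [bracket, A]

lemma span_matchingPoly_le_range_segreCoeff :
    Submodule.span ℂ (Set.range (matchingPoly : (Fin 2 × Fin ℓ ≃ Fin (2 * ℓ)) → _)) ≤
      LinearMap.range (segreCoeff ℓ) :=
  Submodule.span_le.mpr (by rintro _ ⟨τ, rfl⟩; exact matchingPoly_mem_range_segreCoeff τ)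

lemma invariants_le_range_segreCoeff_pow (d : ℕ) :
    invariants (2 * ℓ) (fun _ => d) ≤ LinearMap.range (segreCoeff ℓ) ^ d :=
  (invariants_le_span_matchingPoly_pow finProdFinEquiv d).trans
    (pow_le_pow_left' span_matchingPoly_le_range_segreCoeff d)

end SegreCoefficients

/-! ### The homogeneous coordinate ring of the coefficient variety. -/

section CoordinateRing

/-- Turns generation in degree one into surjectivity in each degree. -/
lemma map_aeval_homogeneousSubmodule {ι S : Type*} [CommRing S] [Algebra ℂ S] (x : ι → S) (d : ℕ) :
    (homogeneousSubmodule ι ℂ d).map (aeval x : MvPolynomial ι ℂ →ₐ[ℂ] S).toLinearMap =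
      Submodule.span ℂ (Set.range x) ^ d := by
  rw [← homogeneousSubmodule_one_pow, Submodule.map_pow, homogeneousSubmodule_one_eq_span_X,
    Submodule.map_span, ← Set.range_comp]
  congr 3
  ext i
  simp

lemma eval_smul_of_isHomogeneous {ι : Type*} {F : MvPolynomial ι ℂ} {d : ℕ}
    (hF : F.IsHomogeneous d) (c : ℂ) (v : ι → ℂ) : eval (c • v) F = c ^ d * eval v F := by
  induction hF using IsWeightedHomogeneous.induction_on with
  | zero => simp
  | add p q _ _ hp hq => rw [map_add, map_add, hp, hq, mul_add]
  | monomial s r hs =>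
    have h : (s.prod fun _ k => c ^ k) = c ^ d := by
      rw [Finsupp.prod, Finset.prod_pow_eq_pow_sum, ← hs]
      congr 1
      simp [Finsupp.weight_apply, Finsupp.sum]
    rw [eval_monomial, eval_monomial, ← h]
    simp only [Pi.smul_apply, smul_eq_mul, mul_pow, Finsupp.prod_mul]
    ring

lemma eval_mk_rep_eq_zero_iff {N : ℕ} {F : MvPolynomial (Fin N) ℂ} {d : ℕ}
    (hF : F.IsHomogeneous d) (v : Fin N → ℂ) (hv : v ≠ 0) :
    eval (Projectivization.mk ℂ v hv).rep F = 0 ↔ eval v F = 0 := by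
  obtain ⟨a, ha⟩ := Projectivization.exists_smul_eq_mk_rep ℂ v hv
  rw [← ha, Units.smul_def, eval_smul_of_isHomogeneous hF, mul_eq_zero,
    or_iff_right (pow_ne_zero _ a.ne_zero)]

lemma exists_eq_mul_matrix_of_mem {k n : ℕ} (W : Gr k n) (A : Matrix (Fin k) (Fin n) ℂ)
    (hA : ∀ i, A i ∈ W.1) : ∃ g : Matrix (Fin k) (Fin k) ℂ, A = g * W.matrix := by
  let b := Module.finBasisOfFinrankEq ℂ W.1 W.2
  refine ⟨Matrix.of fun i j => b.repr ⟨A i, hA i⟩ j, ?_⟩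
  ext i c
  have h := congrArg (fun w : W.1 => (w : Fin n → ℂ) c) (b.sum_repr ⟨A i, hA i⟩)
  simp only [Submodule.coe_sum, Submodule.coe_smul, Finset.sum_apply, Pi.smul_apply,
    smul_eq_mul] at h
  rw [Matrix.mul_apply]
  exact h.symm

/-- A matrix with independent rows is obtained from the chosen basis of its row space. -/
lemma exists_eq_mul_matrix {k n : ℕ} (A : Matrix (Fin k) (Fin n) ℂ)
    (hA : LinearIndependent ℂ A.row) :
    ∃ (W : Gr k n) (g : Matrix (Fin k) (Fin k) ℂ), A = g * W.matrix := by
  let W : Gr k n := ⟨Submodule.span ℂ (Set.range A.row), by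
    rw [finrank_span_eq_card hA, Fintype.card_fin]⟩
  exact ⟨W, exists_eq_mul_matrix_of_mem W A fun i => Submodule.subset_span ⟨i, rfl⟩⟩

variable {ℓ N : ℕ} (e : Module.Basis (Fin N) ℂ (grSections ℓ (2 * ℓ) 2))

/-- A linear functional on all polynomials in `B` extending a coordinate on the sections. -/
def coordExtension (i : Fin N) : MvPolynomial (Fin ℓ × Fin (2 * ℓ)) ℂ →ₗ[ℂ] ℂ :=
  Classical.choose (LinearMap.exists_extend (e.coord i))

lemma coordExtension_apply (i : Fin N) (f : grSections ℓ (2 * ℓ) 2) :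
    coordExtension e i f = e.repr f i :=
  DFunLike.congr_fun (Classical.choose_spec (LinearMap.exists_extend (e.coord i))) f

/-- The coordinates of the Segre form, as polynomials in `A`. -/
def coordPoly (i : Fin N) : MvPolynomial (Fin 2 × Fin (2 * ℓ)) ℂ :=
  segreCoeff ℓ (coordExtension e i)

lemma eval_coordPoly (i : Fin N) (A : Matrix (Fin 2) (Fin (2 * ℓ)) ℂ) :
    eval (fun p => A p.1 p.2) (coordPoly e i) =
      e.equivFun ⟨segreForm A, segreForm_mem A⟩ i := by
  rw [coordPoly, eval_segreCoeff]
  exact coordExtension_apply e i ⟨segreForm A, segreForm_mem A⟩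

/-- All values of the Segre form lie in the space of sections, so any functional on it is a
combination of the coordinates. -/
lemma span_coordPoly :
    Submodule.span ℂ (Set.range (coordPoly e)) = LinearMap.range (segreCoeff ℓ) := by
  refine le_antisymm (Submodule.span_le.mpr (by rintro _ ⟨i, rfl⟩; exact ⟨_, rfl⟩)) ?_
  rintro _ ⟨L, rfl⟩
  have h : segreCoeff ℓ L = ∑ i, L (e i) • coordPoly e i := by
    refine MvPolynomial.funext fun x => ?_
    let A : Matrix (Fin 2) (Fin (2 * ℓ)) ℂ := Matrix.of fun i c => x (i, c)
    have h1 : L (segreForm A) = ∑ i, L (e i) * e.repr ⟨segreForm A, segreForm_mem A⟩ i := by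
      have h2 := congrArg (fun f : grSections ℓ (2 * ℓ) 2 => L f)
        (e.sum_repr ⟨segreForm A, segreForm_mem A⟩)
      simp only [Submodule.coe_sum, Submodule.coe_smul, map_sum, map_smul, smul_eq_mul] at h2
      rw [← h2]
      exact Finset.sum_congr rfl fun i _ => mul_comm _ _
    refine (eval_segreCoeff L A).trans (h1.trans ?_)
    simp only [map_sum, smul_eval]
    exact Finset.sum_congr rfl fun i _ => congrArg (L (e i) * ·) (eval_coordPoly e i A).symm
  rw [h]
  exact sum_mem fun i _ => Submodule.smul_mem _ _ (Submodule.subset_span ⟨i, rfl⟩)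

/-- The pull-back of homogeneous coordinates along the Segre coefficient map. -/
def segrePullback : MvPolynomial (Fin N) ℂ →ₐ[ℂ] MvPolynomial (Fin 2 × Fin (2 * ℓ)) ℂ :=
  aeval (coordPoly e)

lemma eval_segrePullback (F : MvPolynomial (Fin N) ℂ) (A : Matrix (Fin 2) (Fin (2 * ℓ)) ℂ) :
    eval (fun p => A p.1 p.2) (segrePullback e F) =
      eval (e.equivFun ⟨segreForm A, segreForm_mem A⟩) F := by
  have h : (aeval (R := ℂ) fun p : Fin 2 × Fin (2 * ℓ) => A p.1 p.2).comp (segrePullback e) =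
      aeval (e.equivFun ⟨segreForm A, segreForm_mem A⟩) :=
    MvPolynomial.algHom_ext fun i => by
      simpa [segrePullback, aeval_eq_eval] using eval_coordPoly e i A
  simpa [aeval_eq_eval] using DFunLike.congr_fun h F

lemma invariants_le_map_segrePullback (d : ℕ) : invariants (2 * ℓ) (fun _ => d) ≤
    (homogeneousSubmodule (Fin N) ℂ d).map (segrePullback e).toLinearMap := by
  rw [segrePullback, map_aeval_homogeneousSubmodule, span_coordPoly]
  exact invariants_le_range_segreCoeff_pow d

/-- A homogeneous form vanishes on the Segre coefficient variety if and only if its pull-back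
is zero. -/
lemma vanishes_on_coeffVariety_iff (hℓ : 1 ≤ ℓ) {F : MvPolynomial (Fin N) ℂ} {d : ℕ}
    (hF : F.IsHomogeneous d) :
    (∀ q ∈ coeffVariety e, eval q.rep F = 0) ↔ segrePullback e F = 0 := by
  have hgen : (∀ q ∈ coeffVariety e, eval q.rep F = 0) ↔
      ∀ W : Gr 2 (2 * ℓ), W.IsUniform →
        eval (e.equivFun ⟨segreForm W.matrix, segreForm_mem W.matrix⟩) F = 0 := by
    have hW : ∀ (W : Gr 2 (2 * ℓ)) (hW : W.IsUniform), eval (Projectivization.map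
        e.equivFun.toLinearMap e.equivFun.injective (segreMap W hW)).rep F = 0 ↔
          eval (e.equivFun ⟨segreForm W.matrix, segreForm_mem W.matrix⟩) F = 0 := by
      intro W hW
      rw [segreMap, Projectivization.map_mk]
      exact eval_mk_rep_eq_zero_iff hF _ _
    constructor
    · intro h W hU
      refine (hW W hU).mp (h _ ?_)
      exact fun d' G _ hG => hG _ ⟨W, hU, rfl⟩
    · intro h q hq
      refine hq d F hF ?_
      rintro _ ⟨W, hU, rfl⟩
      exact (hW W hU).mpr (h W hU)
  rw [hgen]
  refine ⟨fun h => ?_, fun h W _ => by rw [← eval_segrePullback, h, map_zero]⟩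
  -- Density of uniform matrices: the product of all brackets vanishes off them, so the pull-back
  -- times this product is zero everywhere, and the product can be cancelled.
  let m : (Fin 2 ↪o Fin (2 * ℓ)) → MvPolynomial (Fin 2 × Fin (2 * ℓ)) ℂ :=
    fun I => bracket (I 0) (I 1)
  have hm : ∏ I, m I ≠ 0 := Finset.prod_ne_zero_iff.mpr fun I _ =>
    bracket_ne_zero (I.injective.ne Fin.zero_ne_one)
  refine (mul_eq_zero.mp ?_).resolve_right hm
  refine MvPolynomial.funext fun x => ?_
  let A : Matrix (Fin 2) (Fin (2 * ℓ)) ℂ := Matrix.of fun i c => x (i, c)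
  rw [map_mul, map_zero, map_prod, mul_eq_zero]
  by_cases hA : ∃ I : Fin 2 ↪o Fin (2 * ℓ), (A.submatrix id I).det = 0
  · obtain ⟨I, hI⟩ := hA
    refine Or.inr (Finset.prod_eq_zero (Finset.mem_univ I) ?_)
    rw [Matrix.det_fin_two] at hI
    simpa [m, bracket, A] using hI
  · push Not at hA
    left
    have hrow : LinearIndependent ℂ A.row := by
      have h2 : 2 ≤ 2 * ℓ := by omega
      have h3 := Matrix.linearIndependent_rows_of_det_ne_zero (hA (Fin.castLEOrderEmb h2))
      exact LinearIndependent.of_comp (LinearMap.funLeft ℂ ℂ (Fin.castLEOrderEmb h2)) h3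
    obtain ⟨W, g, hg⟩ := exists_eq_mul_matrix A hrow
    have hU : W.IsUniform := by
      intro I hI
      refine hA I ?_
      rw [hg, Matrix.submatrix_mul _ _ _ id _ Function.bijective_id, Matrix.det_mul]
      exact mul_eq_zero_of_right _ hI
    have h4 : e.equivFun ⟨segreForm A, segreForm_mem A⟩ =
        g.det ^ ℓ • e.equivFun ⟨segreForm W.matrix, segreForm_mem W.matrix⟩ := by
      rw [← map_smul]
      congr 1
      refine Subtype.ext ?_
      change segreForm A = g.det ^ ℓ • segreForm W.matrix
      rw [← segreForm_mul_left, ← hg]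
    refine (eval_segrePullback e F A).trans ?_
    rw [h4, eval_smul_of_isHomogeneous hF, h W hU, mul_zero]

/-! The comparison with the ring of invariants. -/

/-- The ring of invariants as polynomials. -/
def gitToPoly (n : ℕ) : GitRing n →ₐ[ℂ] MvPolynomial (Fin 2 × Fin n) ℂ :=
  DirectSum.coeAlgHom (gitInvariants n)

lemma gitToPoly_gitOf (n d : ℕ) (f : gitInvariants n d) : gitToPoly n (gitOf n d f) = f :=
  DirectSum.coeAlgHom_of _ _ _

lemma coordPoly_mem_gitInvariants (i : Fin N) : coordPoly e i ∈ gitInvariants (2 * ℓ) 1 :=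
  segreCoeff_mem_invariants _

/-- The map from the homogeneous coordinate ring of the projective space to the ring of
invariants. -/
def toGitRing : MvPolynomial (Fin N) ℂ →ₐ[ℂ] GitRing (2 * ℓ) :=
  aeval fun i => gitOf (2 * ℓ) 1 ⟨coordPoly e i, coordPoly_mem_gitInvariants e i⟩

lemma gitToPoly_toGitRing (F : MvPolynomial (Fin N) ℂ) :
    gitToPoly (2 * ℓ) (toGitRing e F) = segrePullback e F := by
  have h : (gitToPoly (2 * ℓ)).comp (toGitRing e) = segrePullback e :=
    MvPolynomial.algHom_ext fun i => by
      simp [toGitRing, segrePullback, gitToPoly_gitOf]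
  exact DFunLike.congr_fun h F

lemma toGitRing_mem {F : MvPolynomial (Fin N) ℂ} {d : ℕ} (hF : F.IsHomogeneous d) :
    toGitRing e F ∈ gitGrading (2 * ℓ) d := by
  have h : toGitRing e F ∈ (homogeneousSubmodule (Fin N) ℂ d).map (toGitRing e).toLinearMap :=
    ⟨F, hF, rfl⟩
  rw [toGitRing, map_aeval_homogeneousSubmodule] at h
  have h1 : ∀ k : ℕ, gitGrading (2 * ℓ) 1 ^ k ≤ gitGrading (2 * ℓ) k := by
    intro k
    induction k with
    | zero =>
      rw [pow_zero, Submodule.one_le]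
      exact SetLike.GradedOne.one_mem
    | succ k ih =>
      rw [pow_succ]
      exact Submodule.mul_le.mpr fun a ha b hb => SetLike.GradedMul.mul_mem (ih ha) hb
  have h2 : Submodule.span ℂ (Set.range fun i => gitOf (2 * ℓ) 1
      ⟨coordPoly e i, coordPoly_mem_gitInvariants e i⟩) ≤ gitGrading (2 * ℓ) 1 :=
    Submodule.span_le.mpr (by rintro _ ⟨i, rfl⟩; exact ⟨_, rfl⟩)
  have h3 := (pow_le_pow_left' h2 d).trans (h1 d)
  exact h3 h

/-- On a single graded piece `gitToPoly` is the inclusion of a subspace, hence injective. -/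
lemma toGitRing_eq_zero_iff {F : MvPolynomial (Fin N) ℂ} {d : ℕ} (hF : F.IsHomogeneous d) :
    toGitRing e F = 0 ↔ segrePullback e F = 0 := by
  rw [← gitToPoly_toGitRing e F]
  refine ⟨fun h => (congrArg _ h).trans (map_zero _), fun h => ?_⟩
  obtain ⟨f, hf⟩ := toGitRing_mem e hF
  rw [← hf, gitToPoly_gitOf] at h
  rw [← hf, show f = 0 from Subtype.ext h, map_zero]

lemma gitGrading_le_map_toGitRing (d : ℕ) : gitGrading (2 * ℓ) d ≤
    (homogeneousSubmodule (Fin N) ℂ d).map (toGitRing e).toLinearMap := by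
  rintro _ ⟨f, rfl⟩
  obtain ⟨F, hF, hf⟩ := invariants_le_map_segrePullback e d f.2
  refine ⟨F, hF, ?_⟩
  obtain ⟨f', hf'⟩ := toGitRing_mem e hF
  have h1 := gitToPoly_toGitRing e F
  rw [← hf', gitToPoly_gitOf] at h1
  change toGitRing e F = _
  rw [← hf']
  congr 1
  exact Subtype.ext (h1.trans hf)

lemma toGitRing_surjective : Function.Surjective (toGitRing e) := by
  classical
  intro r
  change r ∈ (toGitRing e).range
  rw [← DirectSum.sum_support_decompose (gitGrading (2 * ℓ)) r]
  refine sum_mem fun d _ => ?_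
  obtain ⟨F, -, hF⟩ := gitGrading_le_map_toGitRing e d (DirectSum.decompose (gitGrading (2 * ℓ)) r d).2
  exact ⟨F, hF⟩

/-- Homogeneity of the kernel, needed because the vanishing ideal is defined by homogeneous
generators. -/
lemma toGitRing_homogeneousComponent {F : MvPolynomial (Fin N) ℂ} (hF : toGitRing e F = 0) (d : ℕ) :
    toGitRing e (homogeneousComponent d F) = 0 := by
  have hp : ∀ i, GradedRing.proj (gitGrading (2 * ℓ)) d (toGitRing e (homogeneousComponent i F)) =
      if i = d then toGitRing e (homogeneousComponent i F) else 0 := by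
    intro i
    have hi := toGitRing_mem e (homogeneousComponent_isHomogeneous i F)
    rw [GradedRing.proj_apply]
    split_ifs with h
    · subst h
      exact DirectSum.decompose_of_mem_same _ hi
    · exact DirectSum.decompose_of_mem_ne _ hi h
  have h1 := congrArg (fun G => GradedRing.proj (gitGrading (2 * ℓ)) d (toGitRing e G))
    (sum_homogeneousComponent F)
  simp only [hF, map_sum, hp, map_zero, Finset.sum_ite_eq', Finset.mem_range] at h1
  by_cases hd : d < F.totalDegree + 1
  · rwa [if_pos hd] at h1
  · rw [homogeneousComponent_eq_zero d F (by omega), map_zero]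

lemma vanishingIdeal_eq_ker (hℓ : 1 ≤ ℓ) :
    vanishingIdeal (coeffVariety e) = RingHom.ker (toGitRing e) := by
  refine le_antisymm (Ideal.span_le.mpr ?_) fun F hF => ?_
  · rintro F ⟨⟨d, hd⟩, hF⟩
    exact (toGitRing_eq_zero_iff e hd).mpr ((vanishes_on_coeffVariety_iff e hℓ hd).mp hF)
  · rw [← sum_homogeneousComponent F]
    refine sum_mem fun d _ => Ideal.subset_span ?_
    have hd := homogeneousComponent_isHomogeneous d F
    exact ⟨⟨d, hd⟩, (vanishes_on_coeffVariety_iff e hℓ hd).mpr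
      ((toGitRing_eq_zero_iff e hd).mp (toGitRing_homogeneousComponent e hF d))⟩

/-- The Segre coefficient variety is the GIT quotient. -/
theorem nonempty_projVariety_iso_gitQuotient (hℓ : 1 ≤ ℓ) :
    Nonempty (projVariety (coeffVariety e) ≅ gitQuotient (2 * ℓ)) := by
  let f : CoordRing (coeffVariety e) ≃ₐ[ℂ] GitRing (2 * ℓ) :=
    (Ideal.quotientEquivAlgOfEq ℂ (vanishingIdeal_eq_ker e hℓ)).trans
      (Ideal.quotientKerAlgEquivOfSurjective (toGitRing_surjective e))
  have hf : ∀ F, f (Ideal.Quotient.mk _ F) = toGitRing e F := fun F => rfl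
  refine nonempty_projOver_iso f fun d => le_antisymm ?_ ?_
  · rintro _ ⟨_, ⟨F, hF, rfl⟩, rfl⟩
    exact toGitRing_mem e hF
  · intro r hr
    obtain ⟨F, hF, rfl⟩ := gitGrading_le_map_toGitRing e d hr
    exact ⟨_, ⟨F, hF, rfl⟩, rfl⟩

end CoordinateRing

/-! ### Segre points and torus orbit closures. -/

section TorusOrbits

variable {n ℓ : ℕ}

/-- The minor of a `2 × n` matrix in the columns `a` and `b`. -/
def colMinor (A : Matrix (Fin 2) (Fin n) ℂ) (a b : Fin n) : ℂ := A 0 a * A 1 b - A 0 b * A 1 a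

lemma colMinor_swap (A : Matrix (Fin 2) (Fin n) ℂ) (a b : Fin n) :
    colMinor A b a = -colMinor A a b := by
  simp only [colMinor]; ring

lemma eval_bracket (A : Matrix (Fin 2) (Fin n) ℂ) (a b : Fin n) :
    eval (fun p => A p.1 p.2) (bracket a b) = colMinor A a b := by
  simp [bracket, colMinor]

/-- The two-element subset of the columns with elements `a < b`. -/
def pairEmbedding {a b : Fin n} (h : a < b) : Fin 2 ↪o Fin n :=
  OrderEmbedding.ofStrictMono ![a, b] (by
    intro i j hij
    fin_cases i <;> fin_cases j <;> simp_all)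

lemma plucker_pairEmbedding (W : Gr 2 n) {a b : Fin n} (h : a < b) :
    W.plucker (pairEmbedding h) = colMinor W.matrix a b :=
  Matrix.det_fin_two _

lemma Gr.IsUniform.colMinor_ne_zero {W : Gr 2 n} (hW : W.IsUniform) {a b : Fin n} (hab : a ≠ b) :
    colMinor W.matrix a b ≠ 0 := by
  rcases hab.lt_or_gt with h | h
  · rw [← plucker_pairEmbedding W h]; exact hW _
  · rw [colMinor_swap, neg_ne_zero, ← plucker_pairEmbedding W h]; exact hW _

lemma exists_plucker_colMinor (a b : Fin n) : ∃ F : MvPolynomial (Fin 2 ↪o Fin n) ℂ,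
    F.IsHomogeneous 1 ∧ ∀ W : Gr 2 n, eval W.plucker F = colMinor W.matrix a b := by
  rcases lt_trichotomy a b with h | rfl | h
  · exact ⟨X (pairEmbedding h), isHomogeneous_X _ _, fun W => by
      rw [eval_X, plucker_pairEmbedding]⟩
  · exact ⟨0, isHomogeneous_zero _ _ _, fun W => by simp [colMinor]⟩
  · exact ⟨-X (pairEmbedding h), (isHomogeneous_X _ _).neg, fun W => by
      rw [map_neg, eval_X, plucker_pairEmbedding, ← colMinor_swap]⟩

/-- The coefficients of the Segre determinant are forms of degree `ℓ` in the Plücker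
coordinates. -/
lemma exists_plucker_segreCoeff (L : MvPolynomial (Fin ℓ × Fin (2 * ℓ)) ℂ →ₗ[ℂ] ℂ) :
    ∃ F : MvPolynomial (Fin 2 ↪o Fin (2 * ℓ)) ℂ, F.IsHomogeneous ℓ ∧
      ∀ W : Gr 2 (2 * ℓ), eval W.plucker F = L (segreForm W.matrix) := by
  -- Kempe's theorem in degree one writes the coefficient as a combination of products of ℓ minors.
  have h := invariants_le_span_matchingPoly_pow finProdFinEquiv 1 (segreCoeff_mem_invariants L)
  rw [pow_one] at h
  simp only [← eval_segreCoeff]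
  generalize segreCoeff ℓ L = f at h
  induction h using Submodule.span_induction with
  | mem f hf =>
    obtain ⟨τ, rfl⟩ := hf
    choose F hF hF' using fun j => exists_plucker_colMinor (τ (0, j)) (τ (1, j))
    refine ⟨∏ j, F j, ?_, fun W => ?_⟩
    · simpa using IsHomogeneous.prod Finset.univ F (fun _ => 1) fun j _ => hF j
    · rw [matchingPoly, map_prod, map_prod]
      exact Finset.prod_congr rfl fun j _ => by rw [hF' j, eval_bracket]
  | zero => exact ⟨0, isHomogeneous_zero _ _ _, fun W => by simp⟩
  | add f g _ _ hf hg =>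
    obtain ⟨F, hF, hF'⟩ := hf
    obtain ⟨G, hG, hG'⟩ := hg
    exact ⟨F + G, hF.add hG, fun W => by rw [map_add, map_add, hF', hG']⟩
  | smul c f _ hf =>
    obtain ⟨F, hF, hF'⟩ := hf
    exact ⟨c • F, (homogeneousSubmodule _ _ _).smul_mem c hF, fun W => by
      rw [smul_eval, smul_eval, hF']⟩

lemma Gr.matrix_mem {k n : ℕ} (W : Gr k n) (i : Fin k) : W.matrix i ∈ W.1 :=
  (Module.finBasisOfFinrankEq ℂ W.1 W.2 i).2

lemma Gr.mem_torusAct {k n : ℕ} (t : Fin n → ℂˣ) (W : Gr k n) (v : Fin n → ℂ) :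
    v ∈ (W.torusAct t).1 ↔ ∃ w ∈ W.1, (fun c => (t c : ℂ) * w c) = v := Iff.rfl

lemma Gr.torusAct_torusAct {k n : ℕ} (s t : Fin n → ℂˣ) (W : Gr k n) :
    (W.torusAct t).torusAct s = W.torusAct (s * t) := by
  refine Subtype.ext (Submodule.ext fun v => ?_)
  simp only [Gr.mem_torusAct]
  constructor
  · rintro ⟨_, ⟨w, hw, rfl⟩, rfl⟩
    exact ⟨w, hw, by ext c; simp [mul_assoc]⟩
  · rintro ⟨w, hw, rfl⟩
    exact ⟨_, ⟨w, hw, rfl⟩, by ext c; simp [mul_assoc]⟩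

lemma Gr.orbitClosure_torusAct {k n : ℕ} (t : Fin n → ℂˣ) (W : Gr k n) :
    (W.torusAct t).orbitClosure = W.orbitClosure := by
  have h : ∀ P : Gr k n → Prop, (∀ s, P ((W.torusAct t).torusAct s)) ↔ ∀ s, P (W.torusAct s) := by
    intro P
    simp only [Gr.torusAct_torusAct]
    exact ⟨fun h s => by simpa using h (s * t⁻¹), fun h s => h _⟩
  ext U
  simp only [Gr.orbitClosure, Set.mem_ofPred_eq]
  exact forall_congr' fun d => forall_congr' fun F => forall_congr' fun _ =>
    imp_congr (h fun V => eval V.plucker F = 0) Iff.rfl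

lemma Gr.mem_orbitClosure_self {k n : ℕ} (W : Gr k n) : W ∈ W.orbitClosure := by
  intro d F _ h
  have h1 : W.torusAct 1 = W := by
    refine Subtype.ext (Submodule.ext fun v => ?_)
    rw [Gr.mem_torusAct]
    simp
  simpa [h1] using h 1

/-- The Segre forms along a torus orbit are proportional. -/
lemma exists_segreForm_torusAct {W : Gr 2 (2 * ℓ)} (hW : W.IsUniform) (hℓ : 1 ≤ ℓ)
    (t : Fin (2 * ℓ) → ℂˣ) :
    ∃ a : ℂ, ∀ L : MvPolynomial (Fin ℓ × Fin (2 * ℓ)) ℂ →ₗ[ℂ] ℂ,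
      L (segreForm (W.torusAct t).matrix) = a * L (segreForm W.matrix) := by
  -- The rescaled basis matrix and the chosen basis of the translate differ by `g`; the constant
  -- combines the column scalars with the power of det g.
  let A : Matrix (Fin 2) (Fin (2 * ℓ)) ℂ := Matrix.of fun i c => (t c : ℂ) * W.matrix i c
  obtain ⟨g, hg⟩ := exists_eq_mul_matrix_of_mem (W.torusAct t) A fun i =>
    (Gr.mem_torusAct _ _ _).mpr ⟨W.matrix i, W.matrix_mem i, rfl⟩
  have hdet : g.det ≠ 0 := by
    intro h0
    let a : Fin (2 * ℓ) := ⟨0, by omega⟩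
    let b : Fin (2 * ℓ) := ⟨1, by omega⟩
    have hab : a ≠ b := by simp [a, b]
    have h1 : colMinor A a b = t a * t b * colMinor W.matrix a b := by
      simp only [colMinor, A, Matrix.of_apply]; ring
    have h2 : colMinor A a b = g.det * colMinor (W.torusAct t).matrix a b := by
      rw [hg, Matrix.det_fin_two]
      simp only [colMinor, Matrix.mul_apply, Fin.sum_univ_two]; ring
    rw [h0, zero_mul, h1] at h2
    exact mul_ne_zero (mul_ne_zero (t a).ne_zero (t b).ne_zero) (hW.colMinor_ne_zero hab) h2
  refine ⟨(∏ c, (t c : ℂ)) / g.det ^ ℓ, fun L => ?_⟩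
  have h1 : L (segreForm A) = (∏ c, (t c : ℂ)) * L (segreForm W.matrix) := by
    rw [← eval_segreCoeff, ← eval_segreCoeff]
    have := eval_mul_of_isWeightedHomogeneous (fun c => (t c : ℂ))
      (fun p => W.matrix p.1 p.2) (isWeightedHomogeneous_segreCoeff L)
    simpa [A] using this
  rw [hg, segreForm_mul_left, map_smul, smul_eq_mul] at h1
  rw [div_mul_eq_mul_div, ← h1, mul_div_cancel_left₀ _ (pow_ne_zero _ hdet)]

/-- With `W'` fixed, this is the vanishing at `W` of a form of degree ℓ in the Plücker coordinates
that is zero on the orbit of `W'`. -/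
lemma segreForm_mul_eq_of_mem_orbitClosure (hℓ : 1 ≤ ℓ) {W W' : Gr 2 (2 * ℓ)}
    (hW' : W'.IsUniform) (h : W ∈ W'.orbitClosure)
    (L L' : MvPolynomial (Fin ℓ × Fin (2 * ℓ)) ℂ →ₗ[ℂ] ℂ) :
    L (segreForm W.matrix) * L' (segreForm W'.matrix) =
      L (segreForm W'.matrix) * L' (segreForm W.matrix) := by
  obtain ⟨F, hF, hF'⟩ := exists_plucker_segreCoeff L
  obtain ⟨G, hG, hG'⟩ := exists_plucker_segreCoeff L'
  have h1 := h ℓ (L' (segreForm W'.matrix) • F - L (segreForm W'.matrix) • G)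
    (sub_mem (Submodule.smul_mem (homogeneousSubmodule _ _ ℓ) _ hF)
      (Submodule.smul_mem (homogeneousSubmodule _ _ ℓ) _ hG)) fun t => by
    obtain ⟨a, ha⟩ := exists_segreForm_torusAct hW' hℓ t
    rw [map_sub, smul_eval, smul_eval, hF', hG', ha, ha]
    ring
  rw [map_sub, smul_eval, smul_eval, hF', hG'] at h1
  linear_combination h1

lemma segreMap_eq_of_mem_orbitClosure (hℓ : 1 ≤ ℓ) {W W' : Gr 2 (2 * ℓ)} (hW : W.IsUniform)
    (hW' : W'.IsUniform) (h : W ∈ W'.orbitClosure) : segreMap W hW = segreMap W' hW' := by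
  obtain ⟨s, hs⟩ := MvPolynomial.ne_zero_iff.mp (segreForm_ne_zero W'.matrix hW')
  refine (Projectivization.mk_eq_mk_iff' _ _ _ _ _).mpr
    ⟨coeff s (segreForm W.matrix) / coeff s (segreForm W'.matrix), Subtype.ext ?_⟩
  refine MvPolynomial.ext _ _ fun s' => ?_
  have h1 := segreForm_mul_eq_of_mem_orbitClosure hℓ hW' h (lcoeff ℂ s') (lcoeff ℂ s)
  simp only [lcoeff_apply] at h1
  change coeff s' (_ • segreForm W'.matrix) = _
  rw [coeff_smul, smul_eq_mul, div_mul_eq_mul_div, div_eq_iff hs, h1, mul_comm]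

lemma exists_equiv_apply_eq {α β : Type*} [Finite α] (τ₀ : β ≃ α) {k : ℕ} (x : Fin k ↪ β)
    (y : Fin k ↪ α) : ∃ τ : β ≃ α, ∀ i, τ (x i) = y i := by
  have := Equiv.Perm.isMultiplyPretransitive α k
  obtain ⟨ρ, hρ⟩ := MulAction.exists_smul_eq (Equiv.Perm α) (x.trans τ₀.toEmbedding) y
  exact ⟨τ₀.trans ρ, fun i => DFunLike.congr_fun hρ i⟩

/-- Two disjoint edges extend to a perfect matching, by multiple transitivity of the symmetric
group. -/
lemma exists_equiv_of_nodup (τ₀ : Fin 2 × Fin ℓ ≃ Fin n) {j₀ j₁ : Fin ℓ} (hj : j₁ ≠ j₀)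
    {a b c d : Fin n} (habcd : [a, b, c, d].Nodup) : ∃ τ : Fin 2 × Fin ℓ ≃ Fin n,
      τ (0, j₀) = a ∧ τ (0, j₁) = b ∧ τ (1, j₀) = c ∧ τ (1, j₁) = d := by
  have h : [((0 : Fin 2), j₀), (0, j₁), (1, j₀), (1, j₁)].Nodup := by
    simp [hj, hj.symm]
  obtain ⟨τ, hτ⟩ := exists_equiv_apply_eq τ₀ ⟨_, List.nodup_iff_injective_get.mp h⟩
    ⟨_, List.nodup_iff_injective_get.mp habcd⟩
  exact ⟨τ, hτ 0, hτ 1, hτ 2, hτ 3⟩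

/-- Proportional Segre forms have the same cross-ratios. -/
lemma cross_ratio_eq {W W' : Gr 2 (2 * ℓ)} (hW : W.IsUniform) (hW' : W'.IsUniform)
    (h : segreMap W hW = segreMap W' hW') {a b c d : Fin (2 * ℓ)} (habcd : [a, b, c, d].Nodup) :
    colMinor W.matrix a c * colMinor W.matrix b d *
        (colMinor W'.matrix a d * colMinor W'.matrix b c) =
      colMinor W.matrix a d * colMinor W.matrix b c *
        (colMinor W'.matrix a c * colMinor W'.matrix b d) := by
  have hℓ : 2 ≤ ℓ := by
    have := habcd.length_le_card
    simp at this
    omega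
  obtain ⟨u, hu⟩ := (Projectivization.mk_eq_mk_iff' _ _ _ _ _).mp h
  have hu : u • segreForm W'.matrix = segreForm W.matrix := congrArg Subtype.val hu
  let M : Gr 2 (2 * ℓ) → (Fin 2 × Fin ℓ ≃ Fin (2 * ℓ)) → ℂ := fun V τ =>
    ∏ j, colMinor V.matrix (τ (0, j)) (τ (1, j))
  have hM : ∀ τ, M W τ = u * M W' τ := by
    intro τ
    obtain ⟨L, hL⟩ := matchingPoly_mem_range_segreCoeff τ
    have hML : ∀ V : Gr 2 (2 * ℓ), M V τ = L (segreForm V.matrix) := by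
      intro V
      rw [← eval_segreCoeff, hL, matchingPoly, map_prod]
      exact Finset.prod_congr rfl fun j _ => (eval_bracket _ _ _).symm
    rw [hML, hML, ← hu, map_smul, smul_eq_mul]
  let j₀ : Fin ℓ := ⟨0, by omega⟩
  let j₁ : Fin ℓ := ⟨1, by omega⟩
  have hj : j₁ ≠ j₀ := by simp [j₀, j₁]
  obtain ⟨τ, ha, hb, hc, hd⟩ := exists_equiv_of_nodup finProdFinEquiv hj habcd
  -- The edges ac, bd become ad, bc; the other edges give a common nonzero factor `R`.
  let τ' : Fin 2 × Fin ℓ ≃ Fin (2 * ℓ) := (Equiv.swap (1, j₀) (1, j₁)).trans τ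
  have hne : ∀ (i : Fin 2) (j : Fin ℓ), (i = 0 ∨ j ≠ j₀ ∧ j ≠ j₁) → τ' (i, j) = τ (i, j) := by
    intro i j hij
    simp only [τ', Equiv.trans_apply]
    rw [Equiv.swap_apply_of_ne_of_ne]
    · rintro h; rw [Prod.mk.injEq] at h; rcases hij with h' | h'
      · exact absurd (h'.symm.trans h.1) (by decide)
      · exact h'.1 h.2
    · rintro h; rw [Prod.mk.injEq] at h; rcases hij with h' | h'
      · exact absurd (h'.symm.trans h.1) (by decide)
      · exact h'.2 h.2
  let R : Gr 2 (2 * ℓ) → ℂ := fun V => ∏ j ∈ (Finset.univ.erase j₀).erase j₁,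
    colMinor V.matrix (τ (0, j)) (τ (1, j))
  have hsplit : ∀ f : Fin ℓ → ℂ, ∏ j, f j =
      f j₀ * (f j₁ * ∏ j ∈ (Finset.univ.erase j₀).erase j₁, f j) := by
    intro f
    rw [Finset.mul_prod_erase _ _ (Finset.mem_erase.mpr ⟨hj, Finset.mem_univ _⟩),
      Finset.mul_prod_erase _ _ (Finset.mem_univ _)]
  have h1 : ∀ V, M V τ = colMinor V.matrix a c * (colMinor V.matrix b d * R V) := by
    intro V
    simp only [M, R]
    rw [hsplit, ha, hb, hc, hd]
  have h2 : ∀ V, M V τ' = colMinor V.matrix a d * (colMinor V.matrix b c * R V) := by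
    intro V
    simp only [M, R]
    rw [hsplit, hne 0 j₀ (Or.inl rfl), hne 0 j₁ (Or.inl rfl), ha, hb,
      show τ' (1, j₀) = d by simp [τ', hd], show τ' (1, j₁) = c by simp [τ', hc]]
    congr 2
    refine Finset.prod_congr rfl fun j hj' => ?_
    simp only [Finset.mem_erase] at hj'
    rw [hne 0 j (Or.inl rfl), hne 1 j (Or.inr ⟨hj'.2.1, hj'.1⟩)]
  have hR : ∀ {V : Gr 2 (2 * ℓ)}, V.IsUniform → R V ≠ 0 := fun hV =>
    Finset.prod_ne_zero_iff.mpr fun j _ => hV.colMinor_ne_zero (τ.injective.ne (by simp))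
  have h3 : M W τ * M W' τ' = M W τ' * M W' τ := by
    rw [hM τ, hM τ']; ring
  rw [h1, h1, h2, h2] at h3
  refine mul_right_cancel₀ (mul_ne_zero (hR hW) (hR hW')) ?_
  linear_combination h3

/-- Two configurations of points of the projective line with the same cross-ratios differ by a
projective transformation. -/
lemma exists_torus_of_cross_ratio (A A' : Matrix (Fin 2) (Fin n) ℂ)
    (hA : ∀ a b, a ≠ b → colMinor A a b ≠ 0) (hA' : ∀ a b, a ≠ b → colMinor A' a b ≠ 0)
    {p q : Fin n} (hpq : p ≠ q) {r : ℂ} (hr : r ≠ 0)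
    (h : ∀ c, c ≠ p → r * colMinor A c q * colMinor A' p c = colMinor A p c * colMinor A' c q) :
    ∃ (t : Fin n → ℂˣ) (g : Matrix (Fin 2) (Fin 2) ℂ), ∀ i c, t c * A' i c = ∑ j, g i j * A j c := by
  have h0 := hA p q hpq
  have h0' := hA' p q hpq
  -- The scalars forced by comparing coefficients of A'_q in g A_c = s_c A'_c; the coefficients of
  -- A'_p then match by `h`.
  let s : Fin n → ℂ := fun c => if c = p then r else
    colMinor A' p q * colMinor A p c / (colMinor A p q * colMinor A' p c)
  have hs : ∀ c, s c ≠ 0 := by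
    intro c
    by_cases hc : c = p
    · simpa [s, hc] using hr
    · simp only [s, if_neg hc]
      exact div_ne_zero (mul_ne_zero h0' (hA p c (Ne.symm hc)))
        (mul_ne_zero h0 (hA' p c (Ne.symm hc)))
  -- Cramer's rule for the linear map taking A_p to r A'_p and A_q to A'_q.
  refine ⟨fun c => Units.mk0 (s c) (hs c), Matrix.of fun i j =>
    ![(r * A' i p * A 1 q - A' i q * A 1 p) / colMinor A p q,
      (A' i q * A 0 p - r * A' i p * A 0 q) / colMinor A p q] j, fun i c => ?_⟩
  have h1 : ∑ j, (![(r * A' i p * A 1 q - A' i q * A 1 p) / colMinor A p q,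
      (A' i q * A 0 p - r * A' i p * A 0 q) / colMinor A p q] : Fin 2 → ℂ) j * A j c =
      (r * A' i p * colMinor A c q + A' i q * colMinor A p c) / colMinor A p q := by
    simp only [Fin.sum_univ_two, Matrix.cons_val_zero, Matrix.cons_val_one]
    rw [div_mul_eq_mul_div, div_mul_eq_mul_div, ← add_div]
    congr 1
    simp only [colMinor]; ring
  refine Eq.trans ?_ h1.symm
  rw [Units.val_mk0, eq_div_iff h0]
  by_cases hc : c = p
  · subst hc
    simp only [s, if_true, colMinor]; ring
  · have h2 := hA' p c (Ne.symm hc)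
    have h3 : colMinor A' p q * A' i c = colMinor A' c q * A' i p + colMinor A' p c * A' i q := by
      fin_cases i <;> simp only [colMinor, Fin.zero_eta, Fin.mk_one] <;> ring
    simp only [s, if_neg hc]
    rw [div_mul_eq_mul_div, div_mul_eq_mul_div, div_eq_iff (mul_ne_zero h0 h2)]
    linear_combination colMinor A p q * colMinor A p c * h3 - colMinor A p q * A' i p * h c hc

lemma exists_torusAct_eq_of_segreMap_eq (hℓ : 1 ≤ ℓ) {W W' : Gr 2 (2 * ℓ)} (hW : W.IsUniform)
    (hW' : W'.IsUniform) (h : segreMap W hW = segreMap W' hW') : ∃ t, W'.torusAct t = W := by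
  let p : Fin (2 * ℓ) := ⟨0, by omega⟩
  let q : Fin (2 * ℓ) := ⟨1, by omega⟩
  have hpq : p ≠ q := by simp [p, q]
  -- A third column fixes `r`, and equality of cross-ratios gives the relation at the remaining
  -- columns. At q both sides vanish, so with only two columns any nonzero `r` works.
  obtain ⟨r, hr, hr'⟩ : ∃ r : ℂ, r ≠ 0 ∧ ∀ c, c ≠ p →
      r * colMinor W.matrix c q * colMinor W'.matrix p c =
        colMinor W.matrix p c * colMinor W'.matrix c q := by
    by_cases h0 : ∃ c₀, c₀ ≠ p ∧ c₀ ≠ q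
    · obtain ⟨c₀, hp, hq⟩ := h0
      have h1 := hW.colMinor_ne_zero hp.symm
      have h2 := hW.colMinor_ne_zero hq
      have h1' := hW'.colMinor_ne_zero hp.symm
      have h2' := hW'.colMinor_ne_zero hq
      refine ⟨colMinor W.matrix p c₀ * colMinor W'.matrix c₀ q /
        (colMinor W'.matrix p c₀ * colMinor W.matrix c₀ q),
        div_ne_zero (mul_ne_zero h1 h2') (mul_ne_zero h1' h2), fun c hc => ?_⟩
      rw [div_mul_eq_mul_div, div_mul_eq_mul_div, div_eq_iff (mul_ne_zero h1' h2)]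
      by_cases hcq : c = q
      · subst hcq; simp [colMinor]
      by_cases hcc : c = c₀
      · subst hcc; ring
      have h3 := cross_ratio_eq hW hW' h (a := p) (b := q) (c := c₀) (d := c) (by
        simp only [List.nodup_cons, List.mem_cons, not_or]
        simp [hpq, hp.symm, hq.symm, Ne.symm hc, Ne.symm hcq, Ne.symm hcc])
      rw [colMinor_swap _ c q, colMinor_swap _ c₀ q, colMinor_swap _ c q,
        colMinor_swap _ c₀ q] at h3
      linear_combination h3
    · push Not at h0
      refine ⟨1, one_ne_zero, fun c hc => ?_⟩
      rw [h0 c hc]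
      simp [colMinor]
  obtain ⟨t, g, htg⟩ := exists_torus_of_cross_ratio W.matrix W'.matrix
    (fun a b => hW.colMinor_ne_zero) (fun a b => hW'.colMinor_ne_zero) hpq hr hr'
  -- Equal dimensions make one inclusion enough, so invertibility of `g` is never required.
  refine ⟨t, Subtype.ext (Submodule.eq_of_le_of_finrank_eq ?_
    ((W'.torusAct t).2.trans W.2.symm))⟩
  intro v hv
  obtain ⟨w, hw, rfl⟩ := (Gr.mem_torusAct _ _ _).mp hv
  have h1 := (Module.finBasisOfFinrankEq ℂ W'.1 W'.2).sum_repr ⟨w, hw⟩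
  set x := (Module.finBasisOfFinrankEq ℂ W'.1 W'.2).repr ⟨w, hw⟩
  have h2 : (fun c => (t c : ℂ) * w c) = ∑ i, x i • ∑ j, g i j • W.matrix j := by
    ext c
    have h3 : ∑ i, x i * W'.matrix i c = w c := by
      have := congrArg (fun w : W'.1 => (w : Fin (2 * ℓ) → ℂ) c) h1
      simp only [Submodule.coe_sum, Submodule.coe_smul, Finset.sum_apply, Pi.smul_apply,
        smul_eq_mul] at this
      exact this
    simp only [Finset.sum_apply, Pi.smul_apply, smul_eq_mul, ← htg]
    rw [← h3, Finset.mul_sum]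
    exact Finset.sum_congr rfl fun i _ => by ring
  rw [h2]
  exact sum_mem fun i _ => Submodule.smul_mem _ _ (sum_mem fun j _ =>
    Submodule.smul_mem _ _ (W.matrix_mem j))

/-- The Segre determinant determines generic torus orbit closures. -/
theorem segreMap_eq_iff_orbitClosure_eq (hℓ : 1 ≤ ℓ) {W W' : Gr 2 (2 * ℓ)} (hW : W.IsUniform)
    (hW' : W'.IsUniform) :
    segreMap W hW = segreMap W' hW' ↔ W.orbitClosure = W'.orbitClosure := by
  constructor
  · intro h
    obtain ⟨t, rfl⟩ := exists_torusAct_eq_of_segreMap_eq hℓ hW hW' h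
    exact W'.orbitClosure_torusAct t
  · intro h
    exact segreMap_eq_of_mem_orbitClosure hℓ hW hW' (h ▸ W.mem_orbitClosure_self)

end TorusOrbits

end SegreCoeff

end

theorem corollary6p3 (ℓ : ℕ) (hℓ : 1 ≤ ℓ) :
    (∀ (N : ℕ) (e : Module.Basis (Fin N) ℂ (SegreCoeff.grSections ℓ (2 * ℓ) 2)),
      Nonempty (SegreCoeff.projVariety (SegreCoeff.coeffVariety e) ≅
        SegreCoeff.gitQuotient (2 * ℓ))) ∧
    (∀ (W W' : SegreCoeff.Gr 2 (2 * ℓ)) (hW : W.IsUniform) (hW' : W'.IsUniform),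
      SegreCoeff.segreMap W hW = SegreCoeff.segreMap W' hW' ↔
        W.orbitClosure = W'.orbitClosure) :=
  ⟨fun _ e => SegreCoeff.nonempty_projVariety_iso_gitQuotient e hℓ,
    fun _ _ hW hW' => SegreCoeff.segreMap_eq_iff_orbitClosure_eq hℓ hW hW'⟩
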